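/- For each $n$ let $p=p_n$, $k=k_n$, $d=d_n$ be integers, $\theta_1^*,\dots,\theta_k^*\in\mathbb{R}^d$ centers, $z^*\in[k]^p$ a label vector, and $Y_1,\dots,Y_p$ independent with $Y_j\sim\mathcal N(\theta^*_{z_j^*},I_d)$ (the dependence on $n$ is suppressed; all limits and $o(\cdot)$ are as $n\to\infty$). Put $$\Delta_{\min}=\min_{1\le a\ne b\le k}\|\theta_a^*-\theta_b^*\|,\qquad \ell(z,z^*)=\sum_{j=1}^p\|\theta^*_{z_j}-\theta^*_{z_j^*}\|^2,\qquad \mathsf{Misclust}(z,z^*)=\frac1p\sum_{j=1}^p\mathbf 1\{z_j\ne z_j^*\}.$$ Let $z^{(0)}$ be a (random, possibly data-dependent) initial label vector and let $z^{(1)},z^{(2)},\dots$ be produced by Lloyd's algorithm with any tie-breaking, $$z_j^{(t)}\in\operatorname*{argmin}_{a\in[k]}\bigl\|Y_j-\widehat\theta_a(z^{(t-1)})\bigr\|^2,\qquad \widehat\theta_a(z)=\frac{\sum_{j=1}^p\mathbf 1\{z_j=a\}Y_j}{\sum_{j=1}^p\mathbf 1\{z_j=a\}}\qquad(0/0=0).$$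 Assume $$\frac{\Delta_{\min}^2}{k^2(kd/p+1)}\to\infty,\qquad \frac pk\to\infty,\qquad \min_{a\in[k]}\sum_{j=1}^p\mathbf 1\{z_j^*=a\}\ge\frac{\alpha p}{k}$$ for some constant $\alpha>0$, and that $\ell(z^{(0)},z^*)=o(p\Delta_{\min}^2/k)$ holds with probability at least $1-\eta$, i.e. there is a deterministic sequence $\tau=o(p\Delta_{\min}^2/k)$ with $\mathbb P(\ell(z^{(0)},z^*)\le\tau)\ge1-\eta$. Then there is a deterministic $o(1)$ sequence such that, for all sufficiently large $n$, with probability at least $1-\eta-\exp(-\Delta_{\min})-p^{-1}$ all of the following hold: $$\ell(z^{(t)},z^*)\le p\exp\Bigl(-(1+o(1))\frac{\Delta_{\min}^2}{8}\Bigr)+\frac12\,\ell(z^{(t-1)},z^*)\quad\text{for all }t\ge1,$$ $$\mathsf{Misclust}(z^{(t)},z^*)\le\exp\Bigl(-(1+o(1))\frac{\Delta_{\min}^2}{8}\Bigr)+2^{-t}\quad\text{for all }t\ge1,$$ $$\mathsf{Misclust}(z^{(t)},z^*)\le\exp\Bigl(-(1+o(1))\frac{\Delta_{\min}^2}{8}\Bigr)\quad\text{for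 all integers }t\ge3\log p.$$ -/

import Mathlib

open Filter Topology Asymptotics MeasureTheory ProbabilityTheory

namespace GMM

noncomputable section

/-- The minimal separation `Δ_min = min_{a ≠ b} ‖θ_a - θ_b‖` of the `k` centers.  It is meaningful
for `k ≥ 2`; for `k ≤ 1` there is no pair and the value is `0`. -/
def sepMin {d k : ℕ} (θ : Fin k → EuclideanSpace ℝ (Fin d)) : ℝ :=
  ⨅ q : {q : Fin k × Fin k // q.1 ≠ q.2}, ‖θ q.1.1 - θ q.1.2‖

/-- The number of data points with label `a`. -/
def clusterSize {p k : ℕ} (z : Fin p → Fin k) (a : Fin k) : ℕ :=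
  (Finset.univ.filter fun j => z j = a).card

/-- The loss `ℓ(z, z*) = ∑_j ‖θ_{z_j} - θ_{z*_j}‖²`. -/
def loss {d k p : ℕ} (θ : Fin k → EuclideanSpace ℝ (Fin d)) (z zs : Fin p → Fin k) : ℝ :=
  ∑ j, ‖θ (z j) - θ (zs j)‖ ^ 2

/-- The misclustering proportion `(1/p) ∑_j 1{z_j ≠ z*_j}`. -/
def misclust {k p : ℕ} (z zs : Fin p → Fin k) : ℝ :=
  ((Finset.univ.filter fun j => z j ≠ zs j).card : ℝ) / p

/-- The estimated center `θ̂_a(z)`: the average of the data points with label `a`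
(with `0/0 = 0` for an empty cluster). -/
def centerEst {d k p : ℕ} (Y : Fin p → EuclideanSpace ℝ (Fin d)) (z : Fin p → Fin k)
    (a : Fin k) : EuclideanSpace ℝ (Fin d) :=
  (clusterSize z a : ℝ)⁻¹ • ∑ j ∈ Finset.univ.filter (fun j => z j = a), Y j

/-- `z'` is obtained from `z` by one step of Lloyd's algorithm on the data `Y`: each `z' j` is a
minimizer over `a` of `‖Y_j - θ̂_a(z)‖²`.  Ties may be broken in any way. -/
def IsLloydStep {d k p : ℕ} (Y : Fin p → EuclideanSpace ℝ (Fin d)) (z z' : Fin p → Fin k) :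
    Prop :=
  ∀ j, ∀ a, ‖Y j - centerEst Y z (z' j)‖ ^ 2 ≤ ‖Y j - centerEst Y z a‖ ^ 2

/-- The data points `Y_1, …, Y_p` are independent with `Y_j ∼ N(θ_{z*_j}, I_d)`. -/
structure IsGaussianMixture {d k p : ℕ} {Ω : Type*} [MeasurableSpace Ω] (P : Measure Ω)
    (θ : Fin k → EuclideanSpace ℝ (Fin d)) (zs : Fin p → Fin k)
    (Y : Fin p → Ω → EuclideanSpace ℝ (Fin d)) : Prop where
  measurable : ∀ j, Measurable (Y j)
  indep : iIndepFun Y P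
  law : ∀ j, HasLaw (Y j) (multivariateGaussian (θ (zs j)) (1 : Matrix (Fin d) (Fin d) ℝ)) P

end

end GMM

/-!
Why the theorem is true.  Write `e_j` for the noise of the data point `j`, `Δ` for the minimal
separation of the centers and `ℓ_t` for the loss of the `t`-th iterate.

Two events control all the randomness.  The first bounds, for every set `T` of data points at once,
the block energy `∑_a ‖∑_{j ∈ T, z*_j = a} e_j‖² / |{j ∈ T : z*_j = a}|` by `K = 8 (k d + p)`
(`GMM.measure_exists_blockEnergy_gt_le`): it is a chi-square variable with at most `k d` degrees of
freedom, and a union bound over the `2 ^ p` sets suffices, so no operator norm of the noise matrix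
is needed.  The second bounds the ideal error, that is the loss caused by points whose own noise
reaches beyond half of the separation (`GMM.measure_idealError_gt_le`).  There the noise `e_j` is
tested against a vector that contains the noise of the ideal centers with the contribution of `j`
left out, hence is independent of `e_j`; the contribution left out only helps, because it enters as
`-‖e_j‖² / n_a`.  A Gaussian tail bound and Markov's inequality with the factor `exp Δ` give at most
`p exp (-(1 + o(1)) Δ² / 8)` outside of an event of probability `exp (-Δ)`.

On these events everything is deterministic.  The displacement of the estimated centers caused by
wrong labels is controlled by the loss (`GMM.norm_centerEst_sub_sq_le`).  A point misclassified by a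
Lloyd step either contributes to the ideal error, or its noise has a component of relative size `s`
along the displacement; summing this over the points moved from cluster `a` to cluster `b` and using
the block energy bounds their number (`GMM.card_mul_sq_le_of_inner`).  Hence the second kind
contributes at most `ℓ_{t-1} / 2` (`GMM.loss_step_le`), so that `ℓ_t ≤ p ε + ℓ_{t-1} / 2` for all `t`
(`GMM.loss_iterate_le`).  The bounds on the misclustering proportion follow since it is at most
`ℓ_t / (p Δ²)` and a multiple of `1 / p` (`GMM.misclust_iterate_le`).  The signal condition makes all
the relative losses in the exponent tend to zero (`GMM.tendsto_parameters`).
-/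

namespace GMM

open scoped InnerProductSpace RealInnerProductSpace ENNReal

/-! ### Gaussian exponential moments -/

lemma lintegral_pi_prod {ι : Type*} [Fintype ι] {X : ι → Type*} [∀ i, MeasurableSpace (X i)]
    (μ : ∀ i, Measure (X i)) [∀ i, IsProbabilityMeasure (μ i)] (f : ∀ i, X i → ℝ≥0∞)
    (hf : ∀ i, Measurable (f i)) :
    ∫⁻ x, ∏ i, f i (x i) ∂Measure.pi μ = ∏ i, ∫⁻ x, f i x ∂μ i := by
  refine (lintegral_prod_eq_prod_lintegral_of_indepFun Finset.univ
    (fun i (x : ∀ i, X i) => f i (x i))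
    (iIndepFun_pi fun i => (hf i).aemeasurable)
    fun i => (hf i).comp (measurable_pi_apply i)).trans ?_
  refine Finset.prod_congr rfl fun i _ => ?_
  rw [← (measurePreserving_eval μ i).lintegral_comp (hf i)]

lemma lintegral_exp_inner_stdGaussian {d : ℕ} (v : EuclideanSpace ℝ (Fin d)) :
    ∫⁻ x, ENNReal.ofReal (Real.exp ⟪v, x⟫) ∂stdGaussian (EuclideanSpace ℝ (Fin d)) =
      ENNReal.ofReal (Real.exp (‖v‖ ^ 2 / 2)) := by
  have hmap := IsGaussian.map_eq_gaussianReal (μ := stdGaussian (EuclideanSpace ℝ (Fin d)))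
    (innerSL ℝ v)
  rw [integral_strongDual_stdGaussian, variance_dual_stdGaussian, innerSL_apply_norm] at hmap
  have hm : Measurable fun y : ℝ => ENNReal.ofReal (Real.exp y) := by fun_prop
  have h1 : ∫⁻ x, ENNReal.ofReal (Real.exp ⟪v, x⟫) ∂stdGaussian (EuclideanSpace ℝ (Fin d)) =
      ∫⁻ y, ENNReal.ofReal (Real.exp y)
        ∂(stdGaussian (EuclideanSpace ℝ (Fin d))).map (innerSL ℝ v) := by
    rw [lintegral_map hm (by fun_prop)]
    rfl
  have hi := integrable_exp_mul_gaussianReal (μ := 0) (v := (‖v‖ ^ 2).toNNReal) 1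
  have hg := congrFun (mgf_id_gaussianReal (μ := 0) (v := (‖v‖ ^ 2).toNNReal)) 1
  simp only [one_mul] at hi
  rw [h1, hmap, ← ofReal_integral_eq_lintegral_ofReal hi (ae_of_all _ fun _ => (Real.exp_pos _).le)]
  simp only [mgf, id, one_mul] at hg
  rw [hg]
  simp

lemma lintegral_exp_sq_div_four_gaussianReal :
    ∫⁻ x, ENNReal.ofReal (Real.exp (x ^ 2 / 4)) ∂gaussianReal 0 1 = ENNReal.ofReal (√2) := by
  rw [gaussianReal_of_var_ne_zero _ one_ne_zero,
    lintegral_withDensity_eq_lintegral_mul _ (measurable_gaussianPDF 0 1) (by fun_prop)]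
  have h : ∀ x : ℝ, (gaussianPDF 0 1 * fun x => ENNReal.ofReal (Real.exp (x ^ 2 / 4))) x =
      ENNReal.ofReal ((√(2 * Real.pi))⁻¹ * Real.exp (-(1 / 4) * x ^ 2)) := by
    intro x
    rw [Pi.mul_apply, gaussianPDF, ← ENNReal.ofReal_mul (gaussianPDFReal_nonneg _ _ _),
      gaussianPDFReal]
    simp only [NNReal.coe_one, mul_one, sub_zero]
    rw [mul_assoc, ← Real.exp_add]
    congr 3
    ring
  simp_rw [h]
  rw [← ofReal_integral_eq_lintegral_ofReal
    ((integrable_exp_neg_mul_sq (by norm_num : (0 : ℝ) < 1 / 4)).const_mul _)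
    (ae_of_all _ fun x => by positivity), integral_const_mul, integral_gaussian]
  congr 1
  rw [← Real.sqrt_inv, ← Real.sqrt_mul (by positivity)]
  congr 1
  field_simp
  norm_num

lemma lintegral_exp_norm_sq_div_four_stdGaussian (d : ℕ) :
    ∫⁻ x, ENNReal.ofReal (Real.exp (‖x‖ ^ 2 / 4)) ∂stdGaussian (EuclideanSpace ℝ (Fin d)) =
      ENNReal.ofReal (√2) ^ d := by
  rw [← map_pi_eq_stdGaussian, lintegral_map (by fun_prop) (by fun_prop)]
  have h : ∀ x : Fin d → ℝ,
      ENNReal.ofReal (Real.exp (‖(WithLp.toLp 2 x : EuclideanSpace ℝ (Fin d))‖ ^ 2 / 4)) =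
        ∏ i, ENNReal.ofReal (Real.exp (x i ^ 2 / 4)) := by
    intro x
    rw [EuclideanSpace.real_norm_sq_eq, Finset.sum_div, Real.exp_sum,
      ENNReal.ofReal_prod_of_nonneg fun _ _ => (Real.exp_pos _).le]
  simp_rw [h]
  rw [lintegral_pi_prod (fun _ : Fin d => gaussianReal 0 1)
    (fun _ x => ENNReal.ofReal (Real.exp (x ^ 2 / 4))) (fun _ => by fun_prop)]
  simp [lintegral_exp_sq_div_four_gaussianReal]

/-- The tail bound for a linear form of a standard Gaussian vector whose coefficient vector `V` is
random, independent of the Gaussian, and controlled in norm only on the event considered. -/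
lemma measure_le_inner_of_indepFun {d : ℕ} {Ω : Type*} [MeasurableSpace Ω] {P : Measure Ω}
    [IsProbabilityMeasure P] {X V : Ω → EuclideanSpace ℝ (Fin d)} (hXm : Measurable X)
    (hVm : Measurable V) (hX : P.map X = stdGaussian (EuclideanSpace ℝ (Fin d)))
    (hXV : IndepFun X V P) {s R : ℝ} (hs : 0 ≤ s) (hR : 0 < R) :
    P {ω | s ≤ ⟪X ω, V ω⟫ ∧ ‖V ω‖ ≤ R} ≤ ENNReal.ofReal (Real.exp (-(s ^ 2 / (2 * R ^ 2)))) := by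
  set γ := stdGaussian (EuclideanSpace ℝ (Fin d))
  have hVp : IsProbabilityMeasure (P.map V) := Measure.isProbabilityMeasure_map hVm.aemeasurable
  set S : Set (EuclideanSpace ℝ (Fin d) × EuclideanSpace ℝ (Fin d)) :=
    {q | s ≤ ⟪q.2, q.1⟫ ∧ ‖q.1‖ ≤ R} with hS
  have hSm : MeasurableSet S := by
    apply MeasurableSet.inter
    · exact measurableSet_le (f := fun _ : EuclideanSpace ℝ (Fin d) × EuclideanSpace ℝ (Fin d) => s)
        measurable_const (Measurable.inner measurable_snd measurable_fst)
    · exact measurableSet_le (f := fun q : EuclideanSpace ℝ (Fin d) × EuclideanSpace ℝ (Fin d) =>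
        ‖q.1‖) measurable_fst.norm measurable_const
  have hpair : P.map (fun ω => (V ω, X ω)) = (P.map V).prod γ := by
    rw [(indepFun_iff_map_prod_eq_prod_map_map hVm.aemeasurable hXm.aemeasurable).1 hXV.symm, hX]
  have h1 : P {ω | s ≤ ⟪X ω, V ω⟫ ∧ ‖V ω‖ ≤ R} = ((P.map V).prod γ) S := by
    rw [← hpair, Measure.map_apply (hVm.prodMk hXm) hSm]
    rfl
  rw [h1, Measure.prod_apply hSm]
  have hfib : ∀ v, γ (Prod.mk v ⁻¹' S) ≤ ENNReal.ofReal (Real.exp (-(s ^ 2 / (2 * R ^ 2)))) := by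
    intro v
    by_cases hv : ‖v‖ ≤ R
    · -- Markov's inequality for `exp (l ⟪v, x⟫)` with the optimal `l = s / R²`
      set l := s / R ^ 2 with hl
      have hl0 : 0 ≤ l := by positivity
      have hsub : Prod.mk v ⁻¹' S ⊆ {x | ENNReal.ofReal (Real.exp (l * s)) ≤
          ENNReal.ofReal (Real.exp ⟪l • v, x⟫)} := by
        intro x hx
        have hx1 : s ≤ ⟪x, v⟫ := hx.1
        simp only [Set.mem_ofPred_eq]
        apply ENNReal.ofReal_le_ofReal
        apply Real.exp_le_exp.2
        rw [real_inner_smul_left, real_inner_comm]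
        gcongr
      refine (measure_mono hsub).trans ((meas_ge_le_lintegral_div (by fun_prop) ?_ (by simp)).trans
        ?_)
      · simp [Real.exp_pos]
      rw [lintegral_exp_inner_stdGaussian, ← ENNReal.ofReal_div_of_pos (Real.exp_pos _),
        ← Real.exp_sub]
      apply ENNReal.ofReal_le_ofReal
      apply Real.exp_le_exp.2
      rw [norm_smul, Real.norm_of_nonneg hl0]
      have h2 : (l * ‖v‖) ^ 2 ≤ (l * R) ^ 2 := by gcongr
      have h3 : (l * R) ^ 2 / 2 - l * s = -(s ^ 2 / (2 * R ^ 2)) := by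
        rw [hl]; field_simp; ring
      linarith
    · have : Prod.mk v ⁻¹' S = ∅ := by
        ext x
        simp only [hS, Set.mem_preimage, Set.mem_ofPred_eq, Set.mem_empty_iff_false, iff_false]
        exact fun h => hv h.2
      rw [this]
      simp
  calc ∫⁻ v, γ (Prod.mk v ⁻¹' S) ∂P.map V
      ≤ ∫⁻ _, ENNReal.ofReal (Real.exp (-(s ^ 2 / (2 * R ^ 2)))) ∂P.map V := lintegral_mono hfib
    _ = _ := by simp

/-! ### Uniform control of the noise over all sets of data points -/

/-- The block energy `∑_a ‖∑_{j ∈ T, z_j = a} e_j‖² / |{j ∈ T : z_j = a}|` of the vectors `e` over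
the set `T`, with respect to the partition given by the labels `z`.  Empty blocks contribute `0`.
For standard Gaussian `e` it is a chi-square variable with at most `k d` degrees of freedom. -/
noncomputable def blockEnergy {d k p : ℕ} (z : Fin p → Fin k) (e : Fin p → EuclideanSpace ℝ (Fin d))
    (T : Finset (Fin p)) : ℝ :=
  ∑ a, ‖∑ j ∈ T.filter (fun j => z j = a), e j‖ ^ 2 / ((T.filter fun j => z j = a).card : ℝ)

lemma blockEnergy_nonneg {d k p : ℕ} (z : Fin p → Fin k) (e : Fin p → EuclideanSpace ℝ (Fin d))
    (T : Finset (Fin p)) : 0 ≤ blockEnergy z e T :=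
  Finset.sum_nonneg fun _ _ => by positivity

/-- Linearization: `exp (Q / 4)`, with `Q` the block energy, is the average of
`exp (∑_{j ∈ T} ⟪c_{z_j} w_{z_j}, e_j⟫)` over independent standard Gaussian vectors `w_a`, where
`c_a² = 1 / (2 |{j ∈ T : z_j = a}|)`.  Exchanging the two averages reduces the exponential moment
to that of `‖w_a‖² / 4`. -/
lemma lintegral_exp_blockEnergy_le {d k p : ℕ} {Ω : Type*} [MeasurableSpace Ω] {P : Measure Ω}
    [IsProbabilityMeasure P] (z : Fin p → Fin k) {X : Fin p → Ω → EuclideanSpace ℝ (Fin d)}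
    (hXm : ∀ j, Measurable (X j)) (hX : ∀ j, P.map (X j) = stdGaussian (EuclideanSpace ℝ (Fin d)))
    (hind : iIndepFun X P) (T : Finset (Fin p)) :
    ∫⁻ ω, ENNReal.ofReal (Real.exp (blockEnergy z (fun j => X j ω) T / 4)) ∂P ≤
      ENNReal.ofReal (√2) ^ (k * d) := by
  set γ := stdGaussian (EuclideanSpace ℝ (Fin d)) with hγ
  set m : Fin k → ℕ := fun a => (T.filter fun j => z j = a).card with hm
  set c : Fin k → ℝ := fun a => (√(2 * m a))⁻¹ with hc
  have hc2 : ∀ a, c a ^ 2 = (2 * (m a : ℝ))⁻¹ := by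
    intro a
    simp only [hc, inv_pow]
    rw [Real.sq_sqrt (by positivity)]
  have key1 : ∀ ω, ENNReal.ofReal (Real.exp (blockEnergy z (fun j => X j ω) T / 4)) =
      ∫⁻ w, ENNReal.ofReal (Real.exp (∑ j ∈ T, ⟪c (z j) • w (z j), X j ω⟫))
        ∂Measure.pi fun _ : Fin k => γ := by
    intro ω
    set S : Fin k → EuclideanSpace ℝ (Fin d) :=
      fun a => ∑ j ∈ T.filter (fun j => z j = a), X j ω with hS
    have h1 : ∀ w : Fin k → EuclideanSpace ℝ (Fin d),
        ENNReal.ofReal (Real.exp (∑ j ∈ T, ⟪c (z j) • w (z j), X j ω⟫)) =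
          ∏ a, ENNReal.ofReal (Real.exp ⟪c a • S a, w a⟫) := by
      intro w
      rw [← ENNReal.ofReal_prod_of_nonneg fun _ _ => (Real.exp_pos _).le, ← Real.exp_sum]
      congr 2
      rw [← Finset.sum_fiberwise T z]
      refine Finset.sum_congr rfl fun a _ => ?_
      rw [real_inner_smul_left, hS, sum_inner, Finset.mul_sum]
      refine Finset.sum_congr rfl fun j hj => ?_
      rw [(Finset.mem_filter.1 hj).2, real_inner_smul_left, real_inner_comm]
    simp_rw [h1]
    rw [lintegral_pi_prod (fun _ : Fin k => γ)
      (fun a x => ENNReal.ofReal (Real.exp ⟪c a • S a, x⟫)) (fun a => by fun_prop)]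
    simp_rw [hγ, lintegral_exp_inner_stdGaussian]
    rw [← ENNReal.ofReal_prod_of_nonneg fun _ _ => (Real.exp_pos _).le, ← Real.exp_sum]
    congr 2
    rw [blockEnergy, Finset.sum_div]
    refine Finset.sum_congr rfl fun a _ => ?_
    rw [norm_smul, mul_pow, Real.norm_eq_abs, sq_abs, hc2]
    simp only [hS, hm]
    by_cases h0 : ((T.filter fun j => z j = a).card : ℝ) = 0
    · rw [h0]; simp
    · field_simp
      norm_num
  have key2 : ∀ w : Fin k → EuclideanSpace ℝ (Fin d),
      ∫⁻ ω, ENNReal.ofReal (Real.exp (∑ j ∈ T, ⟪c (z j) • w (z j), X j ω⟫)) ∂P ≤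
        ∏ a, ENNReal.ofReal (Real.exp (‖w a‖ ^ 2 / 4)) := by
    intro w
    have hmeas : ∀ j, Measurable fun x : EuclideanSpace ℝ (Fin d) =>
        ENNReal.ofReal (Real.exp ⟪c (z j) • w (z j), x⟫) := fun j => by fun_prop
    have h2 : ∀ ω, ENNReal.ofReal (Real.exp (∑ j ∈ T, ⟪c (z j) • w (z j), X j ω⟫)) =
        ∏ j ∈ T, ENNReal.ofReal (Real.exp ⟪c (z j) • w (z j), X j ω⟫) := by
      intro ω
      rw [Real.exp_sum, ENNReal.ofReal_prod_of_nonneg fun _ _ => (Real.exp_pos _).le]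
    simp_rw [h2]
    rw [lintegral_prod_eq_prod_lintegral_of_indepFun T
      (fun j ω => ENNReal.ofReal (Real.exp ⟪c (z j) • w (z j), X j ω⟫))
      (hind.comp _ hmeas) fun j => (hmeas j).comp (hXm j)]
    have h3 : ∀ j, ∫⁻ ω, ENNReal.ofReal (Real.exp ⟪c (z j) • w (z j), X j ω⟫) ∂P =
        ENNReal.ofReal (Real.exp (c (z j) ^ 2 * ‖w (z j)‖ ^ 2 / 2)) := by
      intro j
      have := lintegral_map (μ := P) (hmeas j) (hXm j)
      rw [← this, hX j, lintegral_exp_inner_stdGaussian, norm_smul, mul_pow, Real.norm_eq_abs,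
        sq_abs]
    simp_rw [h3]
    rw [← ENNReal.ofReal_prod_of_nonneg fun _ _ => (Real.exp_pos _).le,
      ← ENNReal.ofReal_prod_of_nonneg fun _ _ => (Real.exp_pos _).le, ← Real.exp_sum,
      ← Real.exp_sum]
    apply ENNReal.ofReal_le_ofReal
    apply Real.exp_le_exp.2
    rw [← Finset.sum_fiberwise T z]
    refine Finset.sum_le_sum fun a _ => ?_
    have h4 : ∑ j ∈ T with z j = a, c (z j) ^ 2 * ‖w (z j)‖ ^ 2 / 2 =
        m a * (c a ^ 2 * ‖w a‖ ^ 2 / 2) := by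
      rw [hm, ← nsmul_eq_mul, ← Finset.sum_const]
      refine Finset.sum_congr rfl fun j hj => ?_
      rw [(Finset.mem_filter.1 hj).2]
    rw [h4, hc2]
    by_cases h0 : (m a : ℝ) = 0
    · rw [h0, zero_mul]; positivity
    · apply le_of_eq
      field_simp
      ring
  have hjoint : Measurable fun q : Ω × (Fin k → EuclideanSpace ℝ (Fin d)) =>
      ENNReal.ofReal (Real.exp (∑ j ∈ T, ⟪c (z j) • q.2 (z j), X j q.1⟫)) := by
    apply ENNReal.measurable_ofReal.comp
    apply Real.measurable_exp.comp
    refine Finset.measurable_sum _ fun j _ => ?_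
    apply Measurable.inner
    · exact ((measurable_pi_apply (z j)).comp measurable_snd).const_smul (c (z j))
    · exact (hXm j).comp measurable_fst
  simp_rw [key1]
  rw [lintegral_lintegral_swap hjoint.aemeasurable]
  refine (lintegral_mono key2).trans ?_
  rw [lintegral_pi_prod (fun _ : Fin k => γ)
    (fun _ x => ENNReal.ofReal (Real.exp (‖x‖ ^ 2 / 4))) (fun a => by fun_prop)]
  simp_rw [hγ, lintegral_exp_norm_sq_div_four_stdGaussian]
  rw [Finset.prod_const, Finset.card_univ, Fintype.card_fin, ← pow_mul, mul_comm d k]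

/-- With probability at least `1 - exp (-p)` the block energies of all the `2 ^ p` sets of data
points are at most `8 (k d + p)`. -/
lemma measure_exists_blockEnergy_gt_le {d k p : ℕ} {Ω : Type*} [MeasurableSpace Ω] {P : Measure Ω}
    [IsProbabilityMeasure P] (z : Fin p → Fin k) {X : Fin p → Ω → EuclideanSpace ℝ (Fin d)}
    (hXm : ∀ j, Measurable (X j)) (hX : ∀ j, P.map (X j) = stdGaussian (EuclideanSpace ℝ (Fin d)))
    (hind : iIndepFun X P) :
    P {ω | ∃ T, 8 * ((k : ℝ) * d + p) < blockEnergy z (fun j => X j ω) T} ≤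
      ENNReal.ofReal (Real.exp (-p)) := by
  set K : ℝ := 8 * ((k : ℝ) * d + p) with hK
  have hsub : {ω | ∃ T, K < blockEnergy z (fun j => X j ω) T} ⊆
      ⋃ T, {ω | ENNReal.ofReal (Real.exp (K / 4)) ≤
        ENNReal.ofReal (Real.exp (blockEnergy z (fun j => X j ω) T / 4))} := by
    rintro ω ⟨T, hT⟩
    refine Set.mem_iUnion.2 ⟨T, ENNReal.ofReal_le_ofReal (Real.exp_le_exp.2 ?_)⟩
    linarith
  have hone : ∀ T, P {ω | ENNReal.ofReal (Real.exp (K / 4)) ≤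
      ENNReal.ofReal (Real.exp (blockEnergy z (fun j => X j ω) T / 4))} ≤
        ENNReal.ofReal (√2 ^ (k * d) / Real.exp (K / 4)) := by
    intro T
    have hmeas : Measurable fun ω =>
        ENNReal.ofReal (Real.exp (blockEnergy z (fun j => X j ω) T / 4)) := by
      unfold blockEnergy
      fun_prop
    refine (meas_ge_le_lintegral_div hmeas.aemeasurable (by simp [Real.exp_pos])
      (by simp)).trans ?_
    rw [ENNReal.ofReal_div_of_pos (Real.exp_pos _), ENNReal.ofReal_pow (Real.sqrt_nonneg _)]
    gcongr
    exact lintegral_exp_blockEnergy_le z hXm hX hind T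
  refine (measure_mono hsub).trans ((measure_iUnion_fintype_le _ _).trans
    ((Finset.sum_le_sum fun T _ => hone T).trans ?_))
  rw [Finset.sum_const, Finset.card_univ, Fintype.card_finset, Fintype.card_fin, nsmul_eq_mul,
    ← ENNReal.ofReal_natCast, ← ENNReal.ofReal_mul (by positivity)]
  apply ENNReal.ofReal_le_ofReal
  have he : (2 : ℝ) ≤ Real.exp 1 := by linarith [Real.add_one_le_exp (1 : ℝ)]
  have h1 : ((2 ^ p : ℕ) : ℝ) ≤ Real.exp p := by
    push_cast
    rw [← Real.exp_one_pow]
    gcongr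
  have h2 : √2 ^ (k * d) ≤ Real.exp ((k : ℝ) * d) := by
    rw [← Nat.cast_mul, ← Real.exp_one_pow]
    gcongr
    refine le_trans ?_ he
    rw [Real.sqrt_le_left (by norm_num)]
    norm_num
  calc ((2 ^ p : ℕ) : ℝ) * (√2 ^ (k * d) / Real.exp (K / 4))
      ≤ Real.exp p * (Real.exp ((k : ℝ) * d) / Real.exp (K / 4)) := by gcongr
    _ = Real.exp (p + ((k : ℝ) * d - K / 4)) := by rw [← Real.exp_sub, ← Real.exp_add]
    _ ≤ Real.exp (-p) := by
        apply Real.exp_le_exp.2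
        have : (0 : ℝ) ≤ (k : ℝ) * d := by positivity
        rw [hK]
        linarith

/-! ### Deterministic analysis of one Lloyd step -/

section Deterministic

variable {d k p : ℕ}

lemma norm_sum_sq_le_card_mul_blockEnergy (z : Fin p → Fin k)
    (e : Fin p → EuclideanSpace ℝ (Fin d)) (T : Finset (Fin p)) :
    ‖∑ j ∈ T, e j‖ ^ 2 ≤ T.card * blockEnergy z e T := by
  have hcard : (T.card : ℝ) = ∑ a, ((T.filter fun j => z j = a).card : ℝ) := by
    rw [← Nat.cast_sum]
    congr 1
    exact Finset.card_eq_sum_card_fiberwise fun _ _ => Finset.mem_coe.2 (Finset.mem_univ _)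
  calc ‖∑ j ∈ T, e j‖ ^ 2 = ‖∑ a, ∑ j ∈ T with z j = a, e j‖ ^ 2 := by
        rw [Finset.sum_fiberwise]
    _ ≤ (∑ a, ‖∑ j ∈ T with z j = a, e j‖) ^ 2 := by
        gcongr
        exact norm_sum_le _ _
    _ ≤ T.card * blockEnergy z e T := by
        rw [hcard, blockEnergy]
        refine Finset.sum_sq_le_sum_mul_sum_of_sq_le_mul _ (fun _ _ => by positivity)
          (fun _ _ => by positivity) fun a _ => ?_
        by_cases h0 : (T.filter fun j => z j = a).card = 0
        · rw [Finset.card_eq_zero.1 h0]; simp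
        · have : ((T.filter fun j => z j = a).card : ℝ) ≠ 0 := by exact_mod_cast h0
          apply le_of_eq
          field_simp

lemma norm_sum_sq_le_card_mul {zs : Fin p → Fin k} {e : Fin p → EuclideanSpace ℝ (Fin d)} {K : ℝ}
    (hK : ∀ T, blockEnergy zs e T ≤ K) (T : Finset (Fin p)) :
    ‖∑ j ∈ T, e j‖ ^ 2 ≤ T.card * K :=
  (norm_sum_sq_le_card_mul_blockEnergy zs e T).trans (by gcongr; exact hK T)

lemma norm_inv_smul_sum_sq_le {zs : Fin p → Fin k} {e : Fin p → EuclideanSpace ℝ (Fin d)} {K : ℝ}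
    (hK : ∀ T, blockEnergy zs e T ≤ K) {T : Finset (Fin p)} {n n₀ : ℝ} (hn₀ : 0 < n₀)
    (hn : n₀ ≤ n) (hT : (T.card : ℝ) ≤ n) : ‖n⁻¹ • ∑ j ∈ T, e j‖ ^ 2 ≤ K / n₀ := by
  have hn' : 0 < n := hn₀.trans_le hn
  have hK0 : 0 ≤ K := (blockEnergy_nonneg zs e ∅).trans (hK ∅)
  rw [norm_smul, mul_pow, norm_inv, Real.norm_of_nonneg hn'.le, inv_pow, inv_mul_eq_div,
    div_le_div_iff₀ (by positivity) hn₀]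
  calc ‖∑ j ∈ T, e j‖ ^ 2 * n₀ ≤ (T.card * K) * n := by
        gcongr
        exact norm_sum_sq_le_card_mul hK T
    _ ≤ (n * K) * n := by gcongr
    _ = K * n ^ 2 := by ring

lemma norm_centerEst_sq_le {zs : Fin p → Fin k} {e : Fin p → EuclideanSpace ℝ (Fin d)} {K n₀ : ℝ}
    (hK : ∀ T, blockEnergy zs e T ≤ K) (hn₀ : 0 < n₀) (hn : ∀ a, n₀ ≤ clusterSize zs a)
    (a : Fin k) : ‖centerEst e zs a‖ ^ 2 ≤ K / n₀ :=
  norm_inv_smul_sum_sq_le hK hn₀ (hn a) le_rfl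

lemma centerEst_true_labels (θ : Fin k → EuclideanSpace ℝ (Fin d)) (zs : Fin p → Fin k)
    (e : Fin p → EuclideanSpace ℝ (Fin d)) {a : Fin k} (ha : (0 : ℝ) < clusterSize zs a) :
    centerEst (fun j => θ (zs j) + e j) zs a = θ a + centerEst e zs a := by
  have h : ∑ j ∈ Finset.univ.filter (fun j => zs j = a), θ (zs j) =
      (clusterSize zs a : ℝ) • θ a := by
    rw [clusterSize, Nat.cast_smul_eq_nsmul, ← Finset.sum_const]
    exact Finset.sum_congr rfl fun j hj => by rw [(Finset.mem_filter.1 hj).2]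
  rw [centerEst, Finset.sum_add_distrib, h, smul_add, inv_smul_smul₀ ha.ne', centerEst]

/-- The number of points misclassified by `z`. -/
def errorCount (z zs : Fin p → Fin k) : ℕ := (Finset.univ.filter fun j => z j ≠ zs j).card

lemma errorCount_mul_sq_le_loss {θ : Fin k → EuclideanSpace ℝ (Fin d)} {Δ : ℝ} (hΔ : 0 ≤ Δ)
    (hsep : ∀ a b, a ≠ b → Δ ≤ ‖θ a - θ b‖) (z zs : Fin p → Fin k) :
    errorCount z zs * Δ ^ 2 ≤ loss θ z zs := by
  rw [errorCount, ← nsmul_eq_mul, ← Finset.sum_const, loss]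
  refine (Finset.sum_le_sum fun j hj => ?_).trans
    (Finset.sum_le_sum_of_subset_of_nonneg (Finset.filter_subset _ _) fun _ _ _ => by positivity)
  gcongr
  exact hsep _ _ (Finset.mem_filter.1 hj).2

lemma norm_le_sq_div {x Δ : ℝ} (hΔ : 0 < Δ) (hx : Δ ≤ x) : x ≤ x ^ 2 / Δ := by
  rw [le_div_iff₀ hΔ]
  nlinarith

/-- Moving the labels from `zs` to `z` displaces an estimated center by an amount controlled by the
loss.  The displacement comes from the centers of the points wrongly put into the cluster, from the
noise of the points entering or leaving the cluster, and from the change of its size. -/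
lemma norm_centerEst_sub_sq_le {θ : Fin k → EuclideanSpace ℝ (Fin d)} {z zs : Fin p → Fin k}
    {e : Fin p → EuclideanSpace ℝ (Fin d)} {K n₀ Δ : ℝ} (hK : ∀ T, blockEnergy zs e T ≤ K)
    (hn₀ : 0 < n₀) (hn : ∀ a, n₀ ≤ clusterSize zs a) (hΔ : 0 < Δ)
    (hsep : ∀ a b, a ≠ b → Δ ≤ ‖θ a - θ b‖) (hm : (errorCount z zs : ℝ) ≤ n₀ / 2) (a : Fin k) :
    ‖centerEst (fun j => θ (zs j) + e j) z a - centerEst (fun j => θ (zs j) + e j) zs a‖ ^ 2 ≤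
      8 * loss θ z zs * (loss θ z zs + 9 * K) / (n₀ ^ 2 * Δ ^ 2) := by
  set ℓ := loss θ z zs with hℓ
  set m : ℝ := ((errorCount z zs : ℕ) : ℝ) with hmdef
  have hK0 : 0 ≤ K := (blockEnergy_nonneg zs e ∅).trans (hK ∅)
  have hℓ0 : 0 ≤ ℓ := Finset.sum_nonneg fun _ _ => by positivity
  have hm0 : 0 ≤ m := Nat.cast_nonneg _
  have hmℓ : m * Δ ^ 2 ≤ ℓ := errorCount_mul_sq_le_loss hΔ.le hsep z zs
  -- `A`, `C`: points with new, respectively true, label `a`; `I`, `O`: points entering, leaving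
  set A := Finset.univ.filter (fun j => z j = a) with hA
  set C := Finset.univ.filter (fun j => zs j = a) with hC
  set I := A.filter (fun j => zs j ≠ a) with hI
  set O := C.filter (fun j => z j ≠ a) with hO
  have hAC : A.filter (fun j => zs j = a) = C.filter (fun j => z j = a) := by
    ext j; simp [hA, hC, and_comm]
  have hIm : (I.card : ℝ) ≤ m := by
    rw [hmdef, errorCount]
    exact_mod_cast Finset.card_le_card fun j hj => by
      simp only [hI, hA, Finset.mem_filter, Finset.mem_univ, true_and] at hj ⊢
      rw [hj.1]; exact fun h => hj.2 h.symm
  have hOm : (O.card : ℝ) ≤ m := by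
    rw [hmdef, errorCount]
    exact_mod_cast Finset.card_le_card fun j hj => by
      simp only [hO, hC, Finset.mem_filter, Finset.mem_univ, true_and] at hj ⊢
      rw [hj.1]; exact hj.2
  have hcardA : (A.card : ℝ) = (A.filter fun j => zs j = a).card + I.card := by
    exact_mod_cast (Finset.card_filter_add_card_filter_not (s := A) (fun j => zs j = a)).symm
  have hcardC : (C.card : ℝ) = (A.filter fun j => zs j = a).card + O.card := by
    rw [hAC]
    exact_mod_cast (Finset.card_filter_add_card_filter_not (s := C) (fun j => z j = a)).symm
  set nA : ℝ := ((A.card : ℕ) : ℝ) with hnA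
  set nC : ℝ := ((C.card : ℕ) : ℝ) with hnC
  have hnCn : n₀ ≤ nC := hn a
  have hdiff : |nC - nA| ≤ m := by
    rw [abs_le]
    have := Nat.cast_nonneg (α := ℝ) I.card
    have := Nat.cast_nonneg (α := ℝ) O.card
    constructor <;> linarith
  have hnAn : n₀ / 2 ≤ nA := by
    have := (abs_le.1 hdiff).2
    linarith
  have hnA0 : 0 < nA := by linarith
  have hnC0 : 0 < nC := by linarith
  set h := centerEst e zs a with hh
  have hsumC : ∑ j ∈ C, e j = nC • h := by
    rw [hh, centerEst]
    exact (smul_inv_smul₀ hnC0.ne' _).symm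
  have hsumA : ∑ j ∈ A, e j = nC • h + ∑ j ∈ I, e j - ∑ j ∈ O, e j := by
    rw [← hsumC, ← Finset.sum_filter_add_sum_filter_not A (fun j => zs j = a),
      ← Finset.sum_filter_add_sum_filter_not C (fun j => z j = a), hAC]
    abel
  have hsumθ : ∑ j ∈ A, θ (zs j) = nA • θ a + ∑ j ∈ A, (θ (zs j) - θ a) := by
    rw [Finset.sum_sub_distrib, Finset.sum_const, hnA, Nat.cast_smul_eq_nsmul]
    abel
  have hkey : nA • (centerEst (fun j => θ (zs j) + e j) z a -
      centerEst (fun j => θ (zs j) + e j) zs a) =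
      ∑ j ∈ A, (θ (zs j) - θ a) + (nC - nA) • h + ∑ j ∈ I, e j - ∑ j ∈ O, e j := by
    rw [centerEst_true_labels θ zs e hnC0, smul_sub, centerEst]
    rw [show (clusterSize z a : ℝ) = nA from rfl, smul_inv_smul₀ hnA0.ne',
      Finset.sum_add_distrib, hsumθ, hsumA, sub_smul, smul_add]
    abel
  have hb1 : ‖∑ j ∈ A, (θ (zs j) - θ a)‖ ≤ ℓ / Δ := by
    refine (norm_sum_le _ _).trans ?_
    rw [hℓ, loss, Finset.sum_div]
    refine (Finset.sum_le_sum fun j hj => ?_).trans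
      (Finset.sum_le_sum_of_subset_of_nonneg (Finset.subset_univ A) fun _ _ _ => by positivity)
    rw [← (Finset.mem_filter.1 hj).2, norm_sub_rev]
    by_cases hjj : z j = zs j
    · rw [hjj]; simp
    · exact norm_le_sq_div hΔ (hsep _ _ hjj)
  have hsqrt : ∀ T : Finset (Fin p), (T.card : ℝ) ≤ m → ‖∑ j ∈ T, e j‖ ≤ √(m * K) := by
    intro T hT
    apply Real.le_sqrt_of_sq_le
    exact (norm_sum_sq_le_card_mul hK T).trans (by gcongr)
  have hb2 : ‖(nC - nA) • h‖ ≤ √(m * K) := by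
    apply Real.le_sqrt_of_sq_le
    rw [norm_smul, mul_pow, Real.norm_eq_abs]
    calc |nC - nA| ^ 2 * ‖h‖ ^ 2 ≤ m ^ 2 * (K / n₀) := by
          gcongr
          exact norm_centerEst_sq_le hK hn₀ hn a
      _ = m * K * (m / n₀) := by ring
      _ ≤ m * K * 1 := by
          gcongr
          rw [div_le_one hn₀]
          linarith
      _ = m * K := mul_one _
  have hb : nA * ‖centerEst (fun j => θ (zs j) + e j) z a -
      centerEst (fun j => θ (zs j) + e j) zs a‖ ≤ ℓ / Δ + 3 * √(m * K) := by
    have h1 := congrArg norm hkey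
    rw [norm_smul, Real.norm_of_nonneg hnA0.le] at h1
    rw [h1]
    refine (norm_sub_le _ _).trans ?_
    have h2 := norm_add_le (∑ j ∈ A, (θ (zs j) - θ a) + (nC - nA) • h) (∑ j ∈ I, e j)
    have h3 := norm_add_le (∑ j ∈ A, (θ (zs j) - θ a)) ((nC - nA) • h)
    have h4 := hsqrt I hIm
    have h5 := hsqrt O hOm
    linarith
  set D := ‖centerEst (fun j => θ (zs j) + e j) z a - centerEst (fun j => θ (zs j) + e j) zs a‖
  have hb3 : n₀ / 2 * D ≤ ℓ / Δ + 3 * √(m * K) :=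
    (mul_le_mul_of_nonneg_right hnAn (norm_nonneg _)).trans hb
  have hb4 : (n₀ / 2 * D) ^ 2 ≤ 2 * (ℓ / Δ) ^ 2 + 18 * (m * K) := by
    have h0 : 0 ≤ n₀ / 2 * D := by positivity
    have h1 : (n₀ / 2 * D) ^ 2 ≤ (ℓ / Δ + 3 * √(m * K)) ^ 2 := by gcongr
    have h2 : √(m * K) ^ 2 = m * K := Real.sq_sqrt (by positivity)
    nlinarith [sq_nonneg (ℓ / Δ - 3 * √(m * K))]
  have hmK : m * K ≤ ℓ / Δ ^ 2 * K := by
    gcongr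
    rw [le_div_iff₀ (by positivity)]
    exact hmℓ
  have hb5 : (n₀ / 2 * D) ^ 2 ≤ 2 * ℓ * (ℓ + 9 * K) / Δ ^ 2 := by
    refine hb4.trans ?_
    have : 2 * ℓ * (ℓ + 9 * K) / Δ ^ 2 = 2 * (ℓ / Δ) ^ 2 + 18 * (ℓ / Δ ^ 2 * K) := by
      field_simp
      ring
    rw [this]
    linarith
  rw [le_div_iff₀ (by positivity)]
  rw [le_div_iff₀ (by positivity)] at hb5
  nlinarith

/-- The noise vector that perturbs the separation `θ b - θ (zs j)` seen by the data point `j`: the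
noise of the ideal center of cluster `b` minus that of the cluster of `j` with the contribution of
`j` itself left out, which makes it independent of the noise of `j`. -/
noncomputable def leaveOneOut (zs : Fin p → Fin k) (e : Fin p → EuclideanSpace ℝ (Fin d))
    (j : Fin p) (b : Fin k) : EuclideanSpace ℝ (Fin d) :=
  centerEst e zs b - (clusterSize zs (zs j) : ℝ)⁻¹ •
    ∑ i ∈ (Finset.univ.filter fun i => zs i = zs j).erase j, e i

lemma centerEst_eq_leaveOneOut (zs : Fin p → Fin k) (e : Fin p → EuclideanSpace ℝ (Fin d))
    (j : Fin p) (b : Fin k) :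
    centerEst e zs b - centerEst e zs (zs j) =
      leaveOneOut zs e j b - (clusterSize zs (zs j) : ℝ)⁻¹ • e j := by
  rw [leaveOneOut, sub_sub, ← smul_add, Finset.sum_erase_add _ _ (by simp)]
  rfl

lemma norm_leaveOneOut_le {zs : Fin p → Fin k} {e : Fin p → EuclideanSpace ℝ (Fin d)} {K n₀ : ℝ}
    (hK : ∀ T, blockEnergy zs e T ≤ K) (hn₀ : 0 < n₀) (hn : ∀ a, n₀ ≤ clusterSize zs a)
    (j : Fin p) (b : Fin k) : ‖leaveOneOut zs e j b‖ ≤ 2 * √(K / n₀) := by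
  have h1 : ‖centerEst e zs b‖ ≤ √(K / n₀) :=
    Real.le_sqrt_of_sq_le (norm_centerEst_sq_le hK hn₀ hn b)
  have h2 := Real.le_sqrt_of_sq_le (norm_inv_smul_sum_sq_le hK hn₀ (hn (zs j))
    (T := (Finset.univ.filter fun i => zs i = zs j).erase j) (by
      exact_mod_cast Finset.card_le_card (Finset.erase_subset _ _)))
  refine (norm_sub_le _ _).trans ?_
  linarith

/-- If a point with noise `e` and true center `θa` is at least as close to the perturbed center
`θb + ub` as to `θa + ua`, then the noise has a large component along the separation. -/
lemma sq_norm_le_inner_of_closer {E : Type*} [NormedAddCommGroup E] [InnerProductSpace ℝ E]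
    {e θa θb ua ub : E} {r Δ : ℝ} (hr0 : 0 ≤ r) (hr : r ≤ 1) (hΔ : 0 ≤ Δ) (hsep : Δ ≤ ‖θb - θa‖)
    (hua : ‖ua‖ ≤ r * Δ) (hub : ‖ub‖ ≤ r * Δ)
    (hclose : ‖θa + e - (θb + ub)‖ ^ 2 ≤ ‖θa + e - (θa + ua)‖ ^ 2) :
    (1 - 3 * r) / 2 * ‖θb - θa‖ ^ 2 ≤ ⟪e, (θb - θa) + (ub - ua)⟫ := by
  set D := θb - θa
  have e1 : θa + e - (θb + ub) = e - (D + ub) := by simp only [D]; abel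
  have e2 : θa + e - (θa + ua) = e - ua := by abel
  rw [e1, e2, norm_sub_sq_real, norm_sub_sq_real, norm_add_sq_real] at hclose
  have e3 : ⟪e, D + (ub - ua)⟫ = ⟪e, D + ub⟫ - ⟪e, ua⟫ := by
    rw [← inner_sub_right]; congr 1; abel
  rw [e3]
  have h1 : -(‖D‖ * ‖ub‖) ≤ ⟪D, ub⟫ := (abs_le.1 (abs_real_inner_le_norm D ub)).1
  have h2 : ‖D‖ * ‖ub‖ ≤ r * ‖D‖ ^ 2 := by
    have : ‖ub‖ ≤ r * ‖D‖ := hub.trans (by gcongr)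
    nlinarith [norm_nonneg D]
  have h3 : ‖ua‖ ^ 2 ≤ r * ‖D‖ ^ 2 := by
    have : ‖ua‖ ≤ r * ‖D‖ := hua.trans (by gcongr)
    calc ‖ua‖ ^ 2 ≤ (r * ‖D‖) ^ 2 := by gcongr
      _ = r * (r * ‖D‖ ^ 2) := by ring
      _ ≤ 1 * (r * ‖D‖ ^ 2) := by gcongr
      _ = r * ‖D‖ ^ 2 := one_mul _
  nlinarith [sq_nonneg ‖ub‖]

/-- The total separation of a set of points of one cluster `a` all of which have a noise component
of relative size `s` along a common small vector `v`: since the noise of the points adds up to a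
vector of norm at most `√(|T| q)`, the set cannot be large. -/
lemma card_mul_sq_le_of_inner {E ι : Type*} [NormedAddCommGroup E] [InnerProductSpace ℝ E]
    {e : ι → E} {T : Finset ι} {v : E} {s D Δ B : ℝ} (hs : 0 < s) (hΔ : 0 < Δ) (hD : Δ ≤ D)
    (hv : ‖v‖ ^ 2 ≤ 4 * B) (hin : ∀ j ∈ T, s / 2 * D ^ 2 ≤ ⟪e j, v⟫) :
    T.card * D ^ 2 ≤ 16 * B / (s ^ 2 * Δ ^ 2) * (‖∑ j ∈ T, e j‖ ^ 2 / T.card) := by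
  rcases T.eq_empty_or_nonempty with rfl | hT
  · simp
  have hc : (0 : ℝ) < T.card := by exact_mod_cast hT.card_pos
  have h1 : T.card * (s / 2 * D ^ 2) ≤ ‖∑ j ∈ T, e j‖ * ‖v‖ := by
    rw [← nsmul_eq_mul, ← Finset.sum_const]
    refine (Finset.sum_le_sum hin).trans ?_
    rw [← sum_inner]
    exact real_inner_le_norm _ _
  set S := ‖∑ j ∈ T, e j‖
  have hD0 : 0 < D := hΔ.trans_le hD
  have h2 : (T.card * (s / 2 * D ^ 2)) ^ 2 ≤ S ^ 2 * (4 * B) := by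
    calc (T.card * (s / 2 * D ^ 2)) ^ 2 ≤ (S * ‖v‖) ^ 2 := by gcongr
      _ = S ^ 2 * ‖v‖ ^ 2 := by ring
      _ ≤ S ^ 2 * (4 * B) := by gcongr
  rw [div_mul_div_comm, le_div_iff₀ (by positivity)]
  have h3 : (T.card : ℝ) * D ^ 2 * (s ^ 2 * Δ ^ 2 * T.card) ≤
      (T.card : ℝ) * D ^ 2 * (s ^ 2 * D ^ 2 * T.card) := by gcongr
  nlinarith

/-- The ideal error: the loss that would be caused by the misclassifications due to the noise of
the data points themselves, with centers known up to the noise of the ideal centers. -/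
noncomputable def idealError (θ : Fin k → EuclideanSpace ℝ (Fin d)) (zs : Fin p → Fin k)
    (e : Fin p → EuclideanSpace ℝ (Fin d)) (g R : ℝ) : ℝ :=
  open scoped Classical in
  ∑ j, ∑ b, if b ≠ zs j ∧ (1 - g) / 2 * ‖θ b - θ (zs j)‖ ^ 2 ≤
      ⟪e j, (θ b - θ (zs j)) + leaveOneOut zs e j b⟫ ∧ ‖leaveOneOut zs e j b‖ ≤ R
    then ‖θ b - θ (zs j)‖ ^ 2 else 0

open scoped Classical in
/-- One Lloyd step, up to a contraction: the points misclassified after the step either contribute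
to the ideal error, or have a large noise component along the displacement of the estimated
centers, and the total contribution of the latter is controlled by the size of the displacement. -/
lemma loss_step_le {θ : Fin k → EuclideanSpace ℝ (Fin d)} {z z' zs : Fin p → Fin k}
    {e : Fin p → EuclideanSpace ℝ (Fin d)} {K n₀ Δ B r s : ℝ}
    (hK : ∀ T, blockEnergy zs e T ≤ K) (hn₀ : 0 < n₀) (hn : ∀ a, n₀ ≤ clusterSize zs a)
    (hΔ : 0 < Δ) (hsep : ∀ a b, a ≠ b → Δ ≤ ‖θ a - θ b‖) (hs : 0 < s) (hr : r ≤ 1)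
    (hB : ∀ a, ‖centerEst (fun j => θ (zs j) + e j) z a -
      centerEst (fun j => θ (zs j) + e j) zs a‖ ^ 2 ≤ B)
    (hrB : 2 * √(K / n₀) + √B ≤ r * Δ)
    (hz : IsLloydStep (fun j => θ (zs j) + e j) z z') :
    loss θ z' zs ≤ idealError θ zs e (3 * r + s) (r * Δ) +
      k * (16 * B / (s ^ 2 * Δ ^ 2) * K) := by
  set Y := fun j => θ (zs j) + e j with hY
  set v := fun a => centerEst Y z a - centerEst Y zs a with hv
  set h := fun a => centerEst e zs a with hh
  have hn' : ∀ a, (0 : ℝ) < clusterSize zs a := fun a => hn₀.trans_le (hn a)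
  have hcen : ∀ a, centerEst Y z a = θ a + (h a + v a) := by
    intro a
    have := centerEst_true_labels θ zs e (hn' a)
    simp only [hv, hh, hY, this]
    abel
  have hr0 : 0 ≤ r := by
    have : 0 ≤ r * Δ := le_trans (by positivity) hrB
    exact nonneg_of_mul_nonneg_left this hΔ
  have hhn : ∀ a, ‖h a‖ ≤ √(K / n₀) := fun a =>
    Real.le_sqrt_of_sq_le (norm_centerEst_sq_le hK hn₀ hn a)
  have hvn : ∀ a, ‖v a‖ ≤ √B := fun a => Real.le_sqrt_of_sq_le (hB a)
  have hun : ∀ a, ‖h a + v a‖ ≤ r * Δ := fun a =>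
    (norm_add_le _ _).trans (by linarith [hhn a, hvn a, Real.sqrt_nonneg (K / n₀)])
  have hWn : ∀ j b, ‖leaveOneOut zs e j b‖ ≤ r * Δ := fun j b =>
    (norm_leaveOneOut_le hK hn₀ hn j b).trans (by linarith [Real.sqrt_nonneg B])
  have hB0 : ∀ a b, ‖v b - v a‖ ^ 2 ≤ 4 * B := by
    intro a b
    have h1 := norm_sub_le (v b) (v a)
    have h2 : ‖v b - v a‖ ^ 2 ≤ (‖v b‖ + ‖v a‖) ^ 2 := by gcongr
    nlinarith [hB a, hB b, sq_nonneg (‖v b‖ - ‖v a‖)]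
  -- the points moved to `b` because of the displacement of the centers
  set T : Fin k → Finset (Fin p) := fun b => Finset.univ.filter fun j =>
    b ≠ zs j ∧ s / 2 * ‖θ b - θ (zs j)‖ ^ 2 ≤ ⟪e j, v b - v (zs j)⟫ with hT
  have hpoint : ∀ j, ‖θ (z' j) - θ (zs j)‖ ^ 2 ≤
      (∑ b, if b ≠ zs j ∧ (1 - (3 * r + s)) / 2 * ‖θ b - θ (zs j)‖ ^ 2 ≤
        ⟪e j, (θ b - θ (zs j)) + leaveOneOut zs e j b⟫ ∧ ‖leaveOneOut zs e j b‖ ≤ r * Δ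
      then ‖θ b - θ (zs j)‖ ^ 2 else 0) +
      ∑ b, if j ∈ T b then ‖θ b - θ (zs j)‖ ^ 2 else 0 := by
    intro j
    set b := z' j with hb
    have hnn1 : ∀ c ∈ Finset.univ, (0 : ℝ) ≤ if c ≠ zs j ∧
        (1 - (3 * r + s)) / 2 * ‖θ c - θ (zs j)‖ ^ 2 ≤
        ⟪e j, (θ c - θ (zs j)) + leaveOneOut zs e j c⟫ ∧ ‖leaveOneOut zs e j c‖ ≤ r * Δ
      then ‖θ c - θ (zs j)‖ ^ 2 else 0 := fun c _ => by split_ifs <;> positivity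
    have hnn2 : ∀ c ∈ Finset.univ, (0 : ℝ) ≤ if j ∈ T c then ‖θ c - θ (zs j)‖ ^ 2 else 0 :=
      fun c _ => by split_ifs <;> positivity
    by_cases hbz : b = zs j
    · rw [hbz, sub_self, norm_zero]
      have := Finset.sum_nonneg hnn1
      have := Finset.sum_nonneg hnn2
      simp only [ne_eq, OfNat.ofNat_ne_zero, not_false_eq_true, zero_pow]
      linarith
    have hstep := hz j (zs j)
    rw [← hb, hcen b, hcen (zs j)] at hstep
    have hgeo := sq_norm_le_inner_of_closer hr0 hr hΔ.le (hsep _ _ hbz) (hun (zs j)) (hun b) hstep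
    -- the contribution of `e j` to the center of its own cluster has the favourable sign
    have hsplit : ⟪e j, (θ b - θ (zs j)) + ((h b + v b) - (h (zs j) + v (zs j)))⟫ ≤
        ⟪e j, (θ b - θ (zs j)) + leaveOneOut zs e j b⟫ + ⟪e j, v b - v (zs j)⟫ := by
      have h1 : (θ b - θ (zs j)) + ((h b + v b) - (h (zs j) + v (zs j))) =
          ((θ b - θ (zs j)) + leaveOneOut zs e j b) + (v b - v (zs j)) -
            (clusterSize zs (zs j) : ℝ)⁻¹ • e j := by
        have := centerEst_eq_leaveOneOut zs e j b
        have h2 : leaveOneOut zs e j b = h b - h (zs j) +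
            (clusterSize zs (zs j) : ℝ)⁻¹ • e j := by
          simp only [hh]; rw [this]; abel
        rw [h2]; abel
      rw [h1, inner_sub_right, inner_add_right, real_inner_smul_right]
      have : 0 ≤ (clusterSize zs (zs j) : ℝ)⁻¹ * ⟪e j, e j⟫ := by
        rw [real_inner_self_eq_norm_sq]; positivity
      linarith
    by_cases hjT : j ∈ T b
    · have h1 := Finset.single_le_sum hnn2 (Finset.mem_univ b)
      rw [if_pos hjT] at h1
      have := Finset.sum_nonneg hnn1
      linarith
    · have hlt : ⟪e j, v b - v (zs j)⟫ < s / 2 * ‖θ b - θ (zs j)‖ ^ 2 := by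
        by_contra hcon
        exact hjT (Finset.mem_filter.2 ⟨Finset.mem_univ _, hbz, not_lt.1 hcon⟩)
      have hcond : (1 - (3 * r + s)) / 2 * ‖θ b - θ (zs j)‖ ^ 2 ≤
          ⟪e j, (θ b - θ (zs j)) + leaveOneOut zs e j b⟫ := by linarith
      have h1 := Finset.single_le_sum hnn1 (Finset.mem_univ b)
      rw [if_pos ⟨hbz, hcond, hWn j b⟩] at h1
      have := Finset.sum_nonneg hnn2
      linarith
  have hTb : ∀ b, (∑ j, if j ∈ T b then ‖θ b - θ (zs j)‖ ^ 2 else 0) ≤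
      16 * B / (s ^ 2 * Δ ^ 2) * K := by
    intro b
    rw [← Finset.sum_filter, Finset.filter_mem_eq_inter, Finset.univ_inter]
    rw [← Finset.sum_fiberwise (T b) zs]
    have hB' : 0 ≤ B := le_trans (by positivity) (hB b)
    calc ∑ a, ∑ j ∈ T b with zs j = a, ‖θ b - θ (zs j)‖ ^ 2
        ≤ ∑ a, 16 * B / (s ^ 2 * Δ ^ 2) *
          (‖∑ j ∈ T b with zs j = a, e j‖ ^ 2 / ((T b).filter fun j => zs j = a).card) := by
          refine Finset.sum_le_sum fun a _ => ?_
          have h1 : ∑ j ∈ T b with zs j = a, ‖θ b - θ (zs j)‖ ^ 2 =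
              ((T b).filter fun j => zs j = a).card * ‖θ b - θ a‖ ^ 2 := by
            rw [← nsmul_eq_mul, ← Finset.sum_const]
            exact Finset.sum_congr rfl fun j hj => by rw [(Finset.mem_filter.1 hj).2]
          rw [h1]
          by_cases hba : b = a
          · rw [hba, sub_self, norm_zero]
            have : 0 ≤ 16 * B / (s ^ 2 * Δ ^ 2) *
              (‖∑ j ∈ T a with zs j = a, e j‖ ^ 2 / ((T a).filter fun j => zs j = a).card) :=
              mul_nonneg (by positivity) (div_nonneg (sq_nonneg _) (Nat.cast_nonneg _))
            rw [zero_pow two_ne_zero, mul_zero]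
            exact this
          · refine card_mul_sq_le_of_inner hs hΔ (hsep _ _ hba) (hB0 a b) fun j hj => ?_
            rw [Finset.mem_filter] at hj
            have := (Finset.mem_filter.1 hj.1).2.2
            rwa [hj.2] at this
      _ = 16 * B / (s ^ 2 * Δ ^ 2) * blockEnergy zs e (T b) := by
          rw [← Finset.mul_sum, blockEnergy]
      _ ≤ _ := by gcongr; exact hK _
  rw [loss, idealError]
  refine (Finset.sum_le_sum fun j _ => hpoint j).trans ?_
  rw [Finset.sum_add_distrib]
  gcongr
  rw [Finset.sum_comm]
  refine (Finset.sum_le_sum fun b _ => hTb b).trans ?_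
  simp

end Deterministic

/-! ### The ideal error -/

section IdealError

variable {d k p : ℕ} {Ω : Type*} [MeasurableSpace Ω] {P : Measure Ω}

open scoped MatrixOrder in
lemma IsGaussianMixture.map_sub_center {θ : Fin k → EuclideanSpace ℝ (Fin d)} {zs : Fin p → Fin k}
    {Y : Fin p → Ω → EuclideanSpace ℝ (Fin d)} (hY : IsGaussianMixture P θ zs Y) (j : Fin p) :
    P.map (fun ω => Y j ω - θ (zs j)) = stdGaussian (EuclideanSpace ℝ (Fin d)) := by
  have h1 : P.map (fun ω => Y j ω - θ (zs j)) = (P.map (Y j)).map fun x => x - θ (zs j) :=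
    (Measure.map_map (g := fun x => x - θ (zs j)) (measurable_id.sub_const _)
      (hY.measurable j)).symm
  rw [h1, (hY.law j).map_eq, multivariateGaussian, Measure.map_map (by fun_prop) (by fun_prop)]
  have : (fun x => x - θ (zs j)) ∘ (fun x => θ (zs j) + (Matrix.toEuclideanCLM (𝕜 := ℝ)
      (CFC.sqrt (1 : Matrix (Fin d) (Fin d) ℝ))) x) = id := by
    ext x
    simp
  rw [this, Measure.map_id]

lemma measurable_leaveOneOut (zs : Fin p → Fin k) (j : Fin p) (b : Fin k) :
    Measurable fun e : Fin p → EuclideanSpace ℝ (Fin d) => leaveOneOut zs e j b := by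
  unfold leaveOneOut centerEst
  fun_prop

lemma leaveOneOut_congr {zs : Fin p → Fin k} {e e' : Fin p → EuclideanSpace ℝ (Fin d)} {j : Fin p}
    {b : Fin k} (hb : b ≠ zs j) (h : ∀ i, i ≠ j → e i = e' i) :
    leaveOneOut zs e j b = leaveOneOut zs e' j b := by
  unfold leaveOneOut centerEst
  congr 2
  · refine Finset.sum_congr rfl fun i hi => h i ?_
    rintro rfl
    exact hb (Finset.mem_filter.1 hi).2.symm
  · exact Finset.sum_congr rfl fun i hi => h i (Finset.ne_of_mem_erase hi)

lemma indepFun_leaveOneOut {zs : Fin p → Fin k} {X : Fin p → Ω → EuclideanSpace ℝ (Fin d)}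
    (hXm : ∀ j, Measurable (X j)) (hind : iIndepFun X P) {j : Fin p} {b : Fin k} (hb : b ≠ zs j) :
    IndepFun (X j) (fun ω => leaveOneOut zs (fun i => X i ω) j b) P := by
  classical
  have h := hind.indepFun_finset {j} (Finset.univ.erase j)
    (Finset.disjoint_singleton_left.2 (Finset.notMem_erase j _)) hXm
  set ψ : ((i : (Finset.univ.erase j : Finset (Fin p))) → EuclideanSpace ℝ (Fin d)) →
      EuclideanSpace ℝ (Fin d) := fun x =>
    leaveOneOut zs (fun i => if hi : i ∈ Finset.univ.erase j then x ⟨i, hi⟩ else 0) j b with hψ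
  have hψm : Measurable ψ := by
    refine (measurable_leaveOneOut zs j b).comp (measurable_pi_lambda _ fun i => ?_)
    by_cases hi : i ∈ Finset.univ.erase j
    · simp only [hi, dif_pos]
      exact measurable_pi_apply _
    · simp only [hi, dif_neg, not_false_eq_true]
      exact measurable_const
  have hφm : Measurable fun x : ({j} : Finset (Fin p)) → EuclideanSpace ℝ (Fin d) =>
      x ⟨j, Finset.mem_singleton_self j⟩ := measurable_pi_apply _
  have h2 := h.comp hφm hψm
  have h3 : (ψ ∘ fun ω (i : (Finset.univ.erase j : Finset (Fin p))) => X i ω) =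
      fun ω => leaveOneOut zs (fun i => X i ω) j b := by
    funext ω
    simp only [hψ, Function.comp]
    exact leaveOneOut_congr hb fun i hi => by simp [hi]
  rw [h3] at h2
  exact h2

/-- The function `x ↦ x exp (-c x / 8)` is decreasing on `[8 / c, ∞)`. -/
lemma mul_exp_neg_le {x y c : ℝ} (hy : 0 < y) (hxy : y ≤ x) (hcy : 8 ≤ c * y) :
    x * Real.exp (-(c * x / 8)) ≤ y * Real.exp (-(c * y / 8)) := by
  have h1 : x / y ≤ Real.exp (c * (x - y) / 8) := by
    have h2 : x / y = (x - y) / y + 1 := by field_simp; ring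
    have h3 : (x - y) / y ≤ c * (x - y) / 8 := by
      rw [div_le_div_iff₀ hy (by norm_num)]
      nlinarith
    linarith [Real.add_one_le_exp (c * (x - y) / 8)]
  rw [div_le_iff₀ hy] at h1
  calc x * Real.exp (-(c * x / 8))
      ≤ Real.exp (c * (x - y) / 8) * y * Real.exp (-(c * x / 8)) := by gcongr
    _ = y * (Real.exp (c * (x - y) / 8) * Real.exp (-(c * x / 8))) := by ring
    _ = y * Real.exp (-(c * y / 8)) := by
        rw [← Real.exp_add]
        congr 2
        ring

variable [IsProbabilityMeasure P]

/-- The probability that a given point is closer to the center `b` than to its own in the ideal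
problem, in which the centers are known up to the leave-one-out noise. -/
lemma measure_ideal_misclassification_le {θ : Fin k → EuclideanSpace ℝ (Fin d)}
    {zs : Fin p → Fin k} {X : Fin p → Ω → EuclideanSpace ℝ (Fin d)}
    (hXm : ∀ j, Measurable (X j)) (hX : ∀ j, P.map (X j) = stdGaussian (EuclideanSpace ℝ (Fin d)))
    (hind : iIndepFun X P) {j : Fin p} {b : Fin k} (hb : b ≠ zs j) {g r Δ : ℝ} (hΔ : 0 < Δ)
    (hsep : Δ ≤ ‖θ b - θ (zs j)‖) (hg : g ≤ 1) (hr : 0 ≤ r) :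
    P {ω | b ≠ zs j ∧ (1 - g) / 2 * ‖θ b - θ (zs j)‖ ^ 2 ≤
      ⟪X j ω, (θ b - θ (zs j)) + leaveOneOut zs (fun i => X i ω) j b⟫ ∧
        ‖leaveOneOut zs (fun i => X i ω) j b‖ ≤ r * Δ} ≤
      ENNReal.ofReal (Real.exp (-(((1 - g) / (1 + r)) ^ 2 * ‖θ b - θ (zs j)‖ ^ 2 / 8))) := by
  set D := θ b - θ (zs j) with hD
  have hD0 : 0 < ‖D‖ := hΔ.trans_le hsep
  set W := fun ω => leaveOneOut zs (fun i => X i ω) j b with hW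
  have hWm : Measurable W := (measurable_leaveOneOut zs j b).comp (measurable_pi_lambda _ hXm)
  have hi : IndepFun (X j) (fun ω => D + W ω) P :=
    (indepFun_leaveOneOut hXm hind hb).comp measurable_id (measurable_const_add D)
  have := measure_le_inner_of_indepFun (hXm j) (hWm.const_add D) (hX j) hi
    (s := (1 - g) / 2 * ‖D‖ ^ 2) (R := (1 + r) * ‖D‖)
    (mul_nonneg (by linarith) (sq_nonneg _)) (by positivity)
  refine (measure_mono ?_).trans (this.trans (le_of_eq ?_))
  · rintro ω ⟨-, h1, h2⟩
    refine ⟨h1, (norm_add_le _ _).trans ?_⟩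
    have : r * Δ ≤ r * ‖D‖ := by gcongr
    linarith
  · congr 3
    field_simp
    norm_num

/-- The expected ideal error.  Each of the at most `p k` terms is largest at the smallest possible
separation. -/
lemma lintegral_idealError_le {θ : Fin k → EuclideanSpace ℝ (Fin d)}
    {zs : Fin p → Fin k} {X : Fin p → Ω → EuclideanSpace ℝ (Fin d)}
    (hXm : ∀ j, Measurable (X j)) (hX : ∀ j, P.map (X j) = stdGaussian (EuclideanSpace ℝ (Fin d)))
    (hind : iIndepFun X P) {g r Δ : ℝ} (hΔ : 0 < Δ)
    (hsep : ∀ a b, a ≠ b → Δ ≤ ‖θ a - θ b‖) (hg : g ≤ 1) (hr : 0 ≤ r)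
    (hc : 8 ≤ ((1 - g) / (1 + r)) ^ 2 * Δ ^ 2) :
    Measurable (fun ω => idealError θ zs (fun i => X i ω) g (r * Δ)) ∧
    ∫⁻ ω, ENNReal.ofReal (idealError θ zs (fun i => X i ω) g (r * Δ)) ∂P ≤
      ENNReal.ofReal (p * k * (Δ ^ 2 * Real.exp (-(((1 - g) / (1 + r)) ^ 2 * Δ ^ 2 / 8)))) := by
  classical
  set c := ((1 - g) / (1 + r)) ^ 2 with hcdef
  set S : Fin p → Fin k → Set Ω := fun j b =>
    {ω | b ≠ zs j ∧ (1 - g) / 2 * ‖θ b - θ (zs j)‖ ^ 2 ≤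
      ⟪X j ω, (θ b - θ (zs j)) + leaveOneOut zs (fun i => X i ω) j b⟫ ∧
        ‖leaveOneOut zs (fun i => X i ω) j b‖ ≤ r * Δ} with hS
  have hWm : ∀ j b, Measurable fun ω => leaveOneOut zs (fun i => X i ω) j b := fun j b =>
    (measurable_leaveOneOut zs j b).comp (measurable_pi_lambda _ hXm)
  have hSm : ∀ j b, MeasurableSet (S j b) := by
    intro j b
    refine (MeasurableSet.const _).inter (MeasurableSet.inter ?_ ?_)
    · exact measurableSet_le measurable_const 
        (Measurable.inner (𝕜 := ℝ) (hXm j) ((hWm j b).const_add (θ b - θ (zs j))))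
    · exact measurableSet_le (hWm j b).norm measurable_const
  have hrepr : ∀ ω, idealError θ zs (fun i => X i ω) g (r * Δ) =
      ∑ j, ∑ b, (S j b).indicator (fun _ => ‖θ b - θ (zs j)‖ ^ 2) ω := by
    intro ω
    unfold idealError
    refine Finset.sum_congr rfl fun j _ => Finset.sum_congr rfl fun b _ => ?_
    rw [Set.indicator_apply]
    congr
  have hindm : ∀ j b, Measurable ((S j b).indicator fun _ => ‖θ b - θ (zs j)‖ ^ 2) := fun j b =>
    measurable_const.indicator (hSm j b)
  refine ⟨?_, ?_⟩
  · simp_rw [hrepr]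
    exact Finset.measurable_sum _ fun j _ => Finset.measurable_sum _ fun b _ => hindm j b
  have hnn : ∀ j b ω, 0 ≤ (S j b).indicator (fun _ => ‖θ b - θ (zs j)‖ ^ 2) ω := fun j b ω =>
    Set.indicator_nonneg (fun _ _ => by positivity) ω
  have h1 : ∀ ω, ENNReal.ofReal (idealError θ zs (fun i => X i ω) g (r * Δ)) =
      ∑ j, ∑ b, ENNReal.ofReal ((S j b).indicator (fun _ => ‖θ b - θ (zs j)‖ ^ 2) ω) := by
    intro ω
    rw [hrepr, ENNReal.ofReal_sum_of_nonneg fun j _ => Finset.sum_nonneg fun b _ => hnn j b ω]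
    exact Finset.sum_congr rfl fun j _ => ENNReal.ofReal_sum_of_nonneg fun b _ => hnn j b ω
  have hterm : ∀ j b, ∫⁻ ω, ENNReal.ofReal
      ((S j b).indicator (fun _ => ‖θ b - θ (zs j)‖ ^ 2) ω) ∂P ≤
        ENNReal.ofReal (Δ ^ 2 * Real.exp (-(c * Δ ^ 2 / 8))) := by
    intro j b
    have h2 : ∀ ω, ENNReal.ofReal ((S j b).indicator (fun _ => ‖θ b - θ (zs j)‖ ^ 2) ω) =
        (S j b).indicator (fun _ => ENNReal.ofReal (‖θ b - θ (zs j)‖ ^ 2)) ω := by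
      intro ω
      by_cases hω : ω ∈ S j b
      · simp only [Set.indicator_of_mem hω]
      · simp only [Set.indicator_of_notMem hω, ENNReal.ofReal_zero]
    simp_rw [h2]
    rw [lintegral_indicator_const (hSm j b)]
    by_cases hb : b = zs j
    · rw [hb]; simp
    have h3 := hsep _ _ hb
    calc ENNReal.ofReal (‖θ b - θ (zs j)‖ ^ 2) * P (S j b)
        ≤ ENNReal.ofReal (‖θ b - θ (zs j)‖ ^ 2) *
          ENNReal.ofReal (Real.exp (-(c * ‖θ b - θ (zs j)‖ ^ 2 / 8))) := by
          gcongr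
          exact measure_ideal_misclassification_le hXm hX hind hb hΔ h3 hg hr
      _ = ENNReal.ofReal (‖θ b - θ (zs j)‖ ^ 2 *
          Real.exp (-(c * ‖θ b - θ (zs j)‖ ^ 2 / 8))) :=
          (ENNReal.ofReal_mul (by positivity)).symm
      _ ≤ _ := ENNReal.ofReal_le_ofReal (mul_exp_neg_le (by positivity) (by gcongr) hc)
  simp_rw [h1]
  rw [lintegral_finsetSum _ fun j _ => Finset.measurable_sum _ fun b _ =>
    (hindm j b).ennreal_ofReal]
  calc ∑ j, ∫⁻ ω, ∑ b, ENNReal.ofReal ((S j b).indicator (fun _ => ‖θ b - θ (zs j)‖ ^ 2) ω) ∂P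
      ≤ ∑ _j : Fin p, ∑ _b : Fin k, ENNReal.ofReal (Δ ^ 2 * Real.exp (-(c * Δ ^ 2 / 8))) := by
        refine Finset.sum_le_sum fun j _ => ?_
        rw [lintegral_finsetSum _ fun b _ => (hindm j b).ennreal_ofReal]
        exact Finset.sum_le_sum fun b _ => hterm j b
    _ = _ := by
        simp only [Finset.sum_const, Finset.card_univ, Fintype.card_fin, nsmul_eq_mul]
        rw [← ENNReal.ofReal_natCast p, ← ENNReal.ofReal_natCast k,
          ← ENNReal.ofReal_mul (by positivity), ← ENNReal.ofReal_mul (by positivity), mul_assoc]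

/-- With probability at least `1 - exp (-Δ)` the ideal error is at most
`p exp (4 Δ - c Δ² / 8)`. -/
lemma measure_idealError_gt_le {θ : Fin k → EuclideanSpace ℝ (Fin d)}
    {zs : Fin p → Fin k} {X : Fin p → Ω → EuclideanSpace ℝ (Fin d)}
    (hXm : ∀ j, Measurable (X j)) (hX : ∀ j, P.map (X j) = stdGaussian (EuclideanSpace ℝ (Fin d)))
    (hind : iIndepFun X P) {g r Δ : ℝ} (hΔ : 0 < Δ)
    (hsep : ∀ a b, a ≠ b → Δ ≤ ‖θ a - θ b‖) (hg : g ≤ 1) (hr : 0 ≤ r)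
    (hc : 8 ≤ ((1 - g) / (1 + r)) ^ 2 * Δ ^ 2) (hp : 0 < p) (hk : (k : ℝ) ≤ Δ) :
    P {ω | p * Real.exp (4 * Δ - ((1 - g) / (1 + r)) ^ 2 * Δ ^ 2 / 8) <
      idealError θ zs (fun i => X i ω) g (r * Δ)} ≤ ENNReal.ofReal (Real.exp (-Δ)) := by
  obtain ⟨hm, hint⟩ := lintegral_idealError_le (P := P) (zs := zs) hXm hX hind hΔ hsep hg hr hc
  set c := ((1 - g) / (1 + r)) ^ 2
  have hp' : (0 : ℝ) < p := by exact_mod_cast hp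
  set t : ℝ := p * Real.exp (4 * Δ - c * Δ ^ 2 / 8) with ht
  have ht0 : 0 < t := by positivity
  have hsub : {ω | t < idealError θ zs (fun i => X i ω) g (r * Δ)} ⊆
      {ω | ENNReal.ofReal t ≤ ENNReal.ofReal (idealError θ zs (fun i => X i ω) g (r * Δ))} :=
    fun ω hω => ENNReal.ofReal_le_ofReal (le_of_lt hω)
  refine (measure_mono hsub).trans ((meas_ge_le_lintegral_div hm.ennreal_ofReal.aemeasurable
    (by simpa using ht0) (by simp)).trans ?_)
  refine (ENNReal.div_le_div_right hint _).trans ?_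
  rw [← ENNReal.ofReal_div_of_pos ht0]
  apply ENNReal.ofReal_le_ofReal
  rw [div_le_iff₀ ht0, ht]
  have hΔe : Δ ≤ Real.exp Δ := by linarith [Real.add_one_le_exp Δ]
  have h3 : (k : ℝ) * Δ ^ 2 ≤ Real.exp (3 * Δ) := by
    calc (k : ℝ) * Δ ^ 2 ≤ Real.exp Δ * Real.exp Δ ^ 2 := by
          gcongr
          exact hk.trans hΔe
      _ = Real.exp (3 * Δ) := by
          rw [← pow_succ', ← Real.exp_nat_mul]
          norm_num
  calc p * k * (Δ ^ 2 * Real.exp (-(c * Δ ^ 2 / 8)))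
      = p * ((k * Δ ^ 2) * Real.exp (-(c * Δ ^ 2 / 8))) := by ring
    _ ≤ p * (Real.exp (3 * Δ) * Real.exp (-(c * Δ ^ 2 / 8))) := by gcongr
    _ = Real.exp (-Δ) * (p * Real.exp (4 * Δ - c * Δ ^ 2 / 8)) := by
        rw [← Real.exp_add, mul_left_comm, ← Real.exp_add]
        congr 2
        ring

end IdealError

/-! ### The Lloyd iterates on the good event -/

section Iteration

variable {d k p : ℕ}

lemma loss_nonneg (θ : Fin k → EuclideanSpace ℝ (Fin d)) (z zs : Fin p → Fin k) :
    0 ≤ loss θ z zs :=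
  Finset.sum_nonneg fun _ _ => by positivity

/-- As long as the loss stays below `L`, a Lloyd step halves it up to the ideal error.  The bound
`L` is preserved because it is at least twice the ideal error. -/
lemma loss_iterate_le {θ : Fin k → EuclideanSpace ℝ (Fin d)} {zs : Fin p → Fin k}
    {z : ℕ → Fin p → Fin k} {e : Fin p → EuclideanSpace ℝ (Fin d)} {K n₀ Δ L r s ξ : ℝ}
    (hK : ∀ T, blockEnergy zs e T ≤ K) (hn₀ : 0 < n₀) (hn : ∀ a, n₀ ≤ clusterSize zs a)
    (hΔ : 0 < Δ) (hsep : ∀ a b, a ≠ b → Δ ≤ ‖θ a - θ b‖) (hs : 0 < s) (hr : r ≤ 1)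
    (hz : ∀ t, IsLloydStep (fun j => θ (zs j) + e j) (z t) (z (t + 1)))
    (hL0 : loss θ (z 0) zs ≤ L) (hξ : idealError θ zs e (3 * r + s) (r * Δ) ≤ ξ)
    (hξL : 2 * ξ ≤ L) (hm : L ≤ n₀ / 2 * Δ ^ 2)
    (hrL : 2 * √(K / n₀) + √(8 * L * (L + 9 * K) / (n₀ ^ 2 * Δ ^ 2)) ≤ r * Δ)
    (hcontr : 256 * k * K * (L + 9 * K) ≤ n₀ ^ 2 * s ^ 2 * Δ ^ 4) (t : ℕ) :
    loss θ (z t) zs ≤ L ∧ loss θ (z (t + 1)) zs ≤ ξ + 1 / 2 * loss θ (z t) zs := by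
  have hK0 : 0 ≤ K := (blockEnergy_nonneg zs e ∅).trans (hK ∅)
  have step : ∀ t, loss θ (z t) zs ≤ L →
      loss θ (z (t + 1)) zs ≤ ξ + 1 / 2 * loss θ (z t) zs := by
    intro t ht
    set ℓ := loss θ (z t) zs with hℓ
    have hℓ0 : 0 ≤ ℓ := loss_nonneg _ _ _
    have herr : (errorCount (z t) zs : ℝ) ≤ n₀ / 2 := by
      have := errorCount_mul_sq_le_loss hΔ.le hsep (z t) zs
      exact le_of_mul_le_mul_right (by linarith) (by positivity : 0 < Δ ^ 2)
    have hdisp := norm_centerEst_sub_sq_le hK hn₀ hn hΔ hsep herr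
    rw [← hℓ] at hdisp
    have hrB : 2 * √(K / n₀) + √(8 * ℓ * (ℓ + 9 * K) / (n₀ ^ 2 * Δ ^ 2)) ≤ r * Δ := by
      refine le_trans ?_ hrL
      gcongr
      linarith
    refine (loss_step_le hK hn₀ hn hΔ hsep hs hr hdisp hrB (hz t)).trans ?_
    refine add_le_add hξ ?_
    have h1 : (k : ℝ) * (16 * (8 * ℓ * (ℓ + 9 * K) / (n₀ ^ 2 * Δ ^ 2)) / (s ^ 2 * Δ ^ 2) * K) =
        (256 * k * K * (ℓ + 9 * K)) * ℓ / (2 * (n₀ ^ 2 * s ^ 2 * Δ ^ 4)) := by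
      field_simp
      ring
    rw [h1, div_le_iff₀ (by positivity)]
    have h2 : 256 * k * K * (ℓ + 9 * K) ≤ n₀ ^ 2 * s ^ 2 * Δ ^ 4 := by
      refine le_trans ?_ hcontr
      gcongr
    nlinarith
  have hL : ∀ t, loss θ (z t) zs ≤ L := by
    intro t
    induction t with
    | zero => exact hL0
    | succ t ih => linarith [step t ih]
  exact ⟨hL t, step t (hL t)⟩

lemma misclust_eq_errorCount_div (z zs : Fin p → Fin k) :
    misclust z zs = (errorCount z zs : ℝ) / p := rfl

lemma half_pow_le_of_three_log_le (hp : 2 ≤ p) {t : ℕ} (ht : 3 * Real.log p ≤ t) :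
    ((1 : ℝ) / 2) ^ t ≤ 1 / (2 * p) := by
  have hp0 : (0 : ℝ) < p := by positivity
  have hp2 : (2 : ℝ) ≤ p := by exact_mod_cast hp
  have hlogp : 0 ≤ Real.log p := Real.log_nonneg (by linarith)
  have h1 : ((1 : ℝ) / 2) ^ t = Real.exp (-(t * Real.log 2)) := by
    rw [one_div, inv_pow, Real.exp_neg, Real.exp_nat_mul, Real.exp_log (by norm_num)]
  have h2 : 1 / (2 * (p : ℝ)) = Real.exp (-(Real.log 2 + Real.log p)) := by
    rw [Real.exp_neg, Real.exp_add, Real.exp_log (by norm_num), Real.exp_log hp0, one_div]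
  rw [h1, h2]
  apply Real.exp_le_exp.2
  have h3 : Real.log 2 ≤ Real.log p := Real.log_le_log (by norm_num) hp2
  have h4 : (2 : ℝ) / 3 ≤ Real.log 2 := by linarith [Real.log_two_gt_d9]
  nlinarith

/-- The conclusion for the iterates when the loss obeys the recursion with ideal error `p ε`.  Since
the misclustering proportion is a multiple of `1 / p`, the term `2⁻ᵗ` can be absorbed as soon as it
is at most `1 / (2 p)`, at the price of a factor `2`. -/
lemma misclust_iterate_le {θ : Fin k → EuclideanSpace ℝ (Fin d)} {zs : Fin p → Fin k}
    {z : ℕ → Fin p → Fin k} {Δ L ε : ℝ} (hp : 2 ≤ p) (hΔ : 2 ≤ Δ)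
    (hsep : ∀ a b, a ≠ b → Δ ≤ ‖θ a - θ b‖) (hε : 0 ≤ ε) (hL : L ≤ p * Δ ^ 2)
    (h : ∀ t, loss θ (z t) zs ≤ L ∧ loss θ (z (t + 1)) zs ≤ p * ε + 1 / 2 * loss θ (z t) zs)
    (t : ℕ) :
    misclust (z t) zs ≤ ε + (1 / 2) ^ t ∧
      (3 * Real.log p ≤ t → misclust (z t) zs ≤ 2 * ε) := by
  have hp0 : (0 : ℝ) < p := by positivity
  have hΔ0 : 0 < Δ := by linarith
  have hloss : loss θ (z t) zs ≤ 2 * (p * ε) + (1 / 2) ^ t * L := by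
    induction t with
    | zero =>
      have := (h 0).1
      have : 0 ≤ p * ε := by positivity
      rw [pow_zero]
      linarith
    | succ t ih =>
      have := (h t).2
      rw [pow_succ]
      linarith
  have hmis : misclust (z t) zs ≤ ε + (1 / 2) ^ t := by
    rw [misclust_eq_errorCount_div, div_le_iff₀ hp0]
    have h1 := errorCount_mul_sq_le_loss hΔ0.le hsep (z t) zs
    have h2 : ((1 : ℝ) / 2) ^ t * L ≤ (1 / 2) ^ t * (p * Δ ^ 2) := by gcongr
    have h3 : 2 * (p * ε) ≤ (p * ε) * Δ ^ 2 := by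
      have h4 : (2 : ℝ) ≤ Δ ^ 2 := by nlinarith
      calc 2 * (p * ε) = (p * ε) * 2 := mul_comm _ _
        _ ≤ (p * ε) * Δ ^ 2 := by gcongr
    refine le_of_mul_le_mul_right ?_ (by positivity : 0 < Δ ^ 2)
    calc (errorCount (z t) zs : ℝ) * Δ ^ 2 ≤ 2 * (p * ε) + (1 / 2) ^ t * L := h1.trans hloss
      _ ≤ (p * ε) * Δ ^ 2 + (1 / 2) ^ t * (p * Δ ^ 2) := add_le_add h3 h2
      _ = (ε + (1 / 2) ^ t) * p * Δ ^ 2 := by ring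
  refine ⟨hmis, fun ht => ?_⟩
  have hpow := half_pow_le_of_three_log_le hp ht
  rcases Nat.eq_zero_or_pos (errorCount (z t) zs) with h0 | h0
  · rw [misclust_eq_errorCount_div, h0]
    simpa using hε
  · have h1 : 1 / (p : ℝ) ≤ misclust (z t) zs := by
      rw [misclust_eq_errorCount_div]
      gcongr
      exact_mod_cast h0
    have h2 : 1 / (2 * (p : ℝ)) = 1 / (p : ℝ) / 2 := by field_simp
    linarith

lemma sepMin_nonneg (θ : Fin k → EuclideanSpace ℝ (Fin d)) : 0 ≤ sepMin θ :=
  Real.iInf_nonneg fun _ => norm_nonneg _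

lemma sepMin_le (θ : Fin k → EuclideanSpace ℝ (Fin d)) {a b : Fin k} (hab : a ≠ b) :
    sepMin θ ≤ ‖θ a - θ b‖ :=
  ciInf_le (f := fun q : {q : Fin k × Fin k // q.1 ≠ q.2} => ‖θ q.1.1 - θ q.1.2‖)
    (Set.finite_range _).bddBelow ⟨(a, b), hab⟩

end Iteration

/-! ### The parameters of the argument -/

section Parameters

/-- The relative perturbation of the centers, in units of the separation: `M` is the signal ratio
`Δ² / (k² (k d / p + 1))` and `ρ = k L / (p Δ²)` the relative size of the bound `L` on the loss. -/
noncomputable def centerRadius (α M ρ : ℝ) : ℝ :=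
  2 * √(8 / (α * M)) + √(8 * ρ * (ρ + 72 / M) / α ^ 2)

/-- The part of the separation given away to the noise along the displacement of the centers, chosen
large enough for a Lloyd step to contract the loss by the factor `1 / 2`. -/
noncomputable def displacementShare (α M ρ : ℝ) : ℝ :=
  √(2048 * (ρ + 72 / M) / (α ^ 2 * M))

/-- The factor lost in the exponent `Δ² / 8` of the ideal error. -/
noncomputable def exponentFactor (α M ρ : ℝ) : ℝ :=
  ((1 - (3 * centerRadius α M ρ + displacementShare α M ρ)) / (1 + centerRadius α M ρ)) ^ 2

lemma tendsto_parameters {α : ℝ} {M ρ : ℕ → ℝ} (hM : Tendsto M atTop atTop)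
    (hρ : Tendsto ρ atTop (𝓝 0)) :
    Tendsto (fun n => centerRadius α (M n) (ρ n)) atTop (𝓝 0) ∧
      Tendsto (fun n => displacementShare α (M n) (ρ n)) atTop (𝓝 0) ∧
      Tendsto (fun n => exponentFactor α (M n) (ρ n)) atTop (𝓝 1) := by
  have hMi : Tendsto (fun n => (M n)⁻¹) atTop (𝓝 0) := hM.inv_tendsto_atTop
  have h72 : Tendsto (fun n => ρ n + 72 / M n) atTop (𝓝 0) := by
    simpa [div_eq_mul_inv] using hρ.add (hMi.const_mul 72)
  have hr : Tendsto (fun n => centerRadius α (M n) (ρ n)) atTop (𝓝 0) := by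
    have h1 : Tendsto (fun n => 8 / (α * M n)) atTop (𝓝 0) := by
      have := hMi.const_mul (8 * α⁻¹)
      rw [mul_zero] at this
      refine this.congr fun n => ?_
      rw [div_eq_mul_inv, mul_inv, mul_assoc]
    have h2 : Tendsto (fun n => 8 * ρ n * (ρ n + 72 / M n) / α ^ 2) atTop (𝓝 0) := by
      have := ((hρ.const_mul 8).mul h72).div_const (α ^ 2)
      simpa using this
    have := (h1.sqrt.const_mul 2).add h2.sqrt
    simpa [centerRadius] using this
  have hs : Tendsto (fun n => displacementShare α (M n) (ρ n)) atTop (𝓝 0) := by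
    have h1 : Tendsto (fun n => 2048 * (ρ n + 72 / M n) / (α ^ 2 * M n)) atTop (𝓝 0) := by
      have := ((h72.const_mul 2048).mul (hMi.const_mul (α ^ 2)⁻¹))
      rw [mul_zero, mul_zero, mul_zero] at this
      refine this.congr fun n => ?_
      rw [← mul_inv, ← div_eq_mul_inv]
    simpa [displacementShare] using h1.sqrt
  refine ⟨hr, hs, ?_⟩
  have h1 := (((tendsto_const_nhds (x := (1 : ℝ))).sub ((hr.const_mul 3).add hs)).div
    ((tendsto_const_nhds (x := (1 : ℝ))).add hr) (by norm_num)).pow 2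
  simpa [exponentFactor] using h1

variable {d k p : ℕ}

/-- With the claimed probability, the noise lies outside of the two exceptional events (a large block
energy, a large ideal error), and then the bounds follow from the deterministic analysis. -/
lemma measureReal_lloyd_bounds_ge_of_parameters {Ω : Type*} [MeasurableSpace Ω] {P : Measure Ω}
    [IsProbabilityMeasure P] {θ : Fin k → EuclideanSpace ℝ (Fin d)} {zs : Fin p → Fin k}
    {Y : Fin p → Ω → EuclideanSpace ℝ (Fin d)} (hY : IsGaussianMixture P θ zs Y)
    {z : ℕ → Ω → Fin p → Fin k}
    (hz : ∀ t ω, IsLloydStep (fun j => Y j ω) (z t ω) (z (t + 1) ω)) {η L n₀ Δ r s ε : ℝ}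
    (hΔ : 2 ≤ Δ) (hsep : ∀ a b, a ≠ b → Δ ≤ ‖θ a - θ b‖) (hn₀ : 0 < n₀)
    (hsize : ∀ a, n₀ ≤ clusterSize zs a) (hp : 2 ≤ p) (hkΔ : (k : ℝ) ≤ Δ) (hs : 0 < s)
    (hr0 : 0 ≤ r) (hr : r ≤ 1) (hg : 3 * r + s ≤ 1)
    (hc : 8 ≤ ((1 - (3 * r + s)) / (1 + r)) ^ 2 * Δ ^ 2) (hεL : 2 * (p * ε) ≤ L)
    (hLm : L ≤ n₀ / 2 * Δ ^ 2) (hLp : L ≤ p * Δ ^ 2)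
    (hrad : 2 * √(8 * ((k : ℝ) * d + p) / n₀) +
      √(8 * L * (L + 9 * (8 * ((k : ℝ) * d + p))) / (n₀ ^ 2 * Δ ^ 2)) ≤ r * Δ)
    (hcontr : 256 * k * (8 * ((k : ℝ) * d + p)) * (L + 9 * (8 * ((k : ℝ) * d + p))) ≤
      n₀ ^ 2 * s ^ 2 * Δ ^ 4)
    (hinit : 1 - η ≤ P.real {ω | loss θ (z 0 ω) zs ≤ L})
    (hε : ε = Real.exp (4 * Δ - ((1 - (3 * r + s)) / (1 + r)) ^ 2 * Δ ^ 2 / 8)) :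
    1 - η - Real.exp (-Δ) - (p : ℝ)⁻¹ ≤ P.real {ω | ∀ t,
      loss θ (z (t + 1) ω) zs ≤ p * ε + 1 / 2 * loss θ (z t ω) zs ∧
      misclust (z t ω) zs ≤ ε + (1 / 2) ^ t ∧
      (3 * Real.log p ≤ t → misclust (z t ω) zs ≤ 2 * ε)} := by
  have hp0 : (0 : ℝ) < p := by positivity
  have hΔ0 : 0 < Δ := by linarith
  have hε0 : 0 ≤ ε := by rw [hε]; positivity
  set X : Fin p → Ω → EuclideanSpace ℝ (Fin d) := fun j ω => Y j ω - θ (zs j) with hX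
  have hXm : ∀ j, Measurable (X j) := fun j => (hY.measurable j).sub_const _
  have hXl : ∀ j, P.map (X j) = stdGaussian (EuclideanSpace ℝ (Fin d)) := hY.map_sub_center
  have hXi : iIndepFun X P := hY.indep.comp (fun j x => x - θ (zs j))
    fun j => measurable_id.sub_const _
  set E₁ : Set Ω := {ω | ∃ T, 8 * ((k : ℝ) * d + p) < blockEnergy zs (fun j => X j ω) T} with hE₁
  set E₂ : Set Ω := {ω | p * ε < idealError θ zs (fun j => X j ω) (3 * r + s) (r * Δ)} with hE₂
  have hP₁ : P.real E₁ ≤ (p : ℝ)⁻¹ := by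
    have h2 : P.real E₁ ≤ Real.exp (-p) := ENNReal.toReal_le_of_le_ofReal (Real.exp_pos _).le
      (measure_exists_blockEnergy_gt_le (P := P) zs hXm hXl hXi)
    refine h2.trans ?_
    rw [Real.exp_neg]
    gcongr
    linarith [Real.add_one_le_exp (p : ℝ)]
  have hP₂ : P.real E₂ ≤ Real.exp (-Δ) := by
    rw [hE₂, hε]
    exact ENNReal.toReal_le_of_le_ofReal (Real.exp_pos _).le
      (measure_idealError_gt_le (P := P) hXm hXl hXi hΔ0 hsep hg hr0 hc (by omega) hkΔ)
  set G : Set Ω := {ω | ∀ t,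
      loss θ (z (t + 1) ω) zs ≤ p * ε + 1 / 2 * loss θ (z t ω) zs ∧
      misclust (z t ω) zs ≤ ε + (1 / 2) ^ t ∧
      (3 * Real.log p ≤ t → misclust (z t ω) zs ≤ 2 * ε)} with hG
  have hsub : {ω | loss θ (z 0 ω) zs ≤ L} ⊆ G ∪ (E₁ ∪ E₂) := by
    intro ω hω
    by_cases h1 : ω ∈ E₁
    · exact Or.inr (Or.inl h1)
    by_cases h2 : ω ∈ E₂
    · exact Or.inr (Or.inr h2)
    left
    have hK : ∀ T, blockEnergy zs (fun j => X j ω) T ≤ 8 * ((k : ℝ) * d + p) := fun T =>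
      not_lt.1 fun hT => h1 ⟨T, hT⟩
    have hYX : (fun j => Y j ω) = fun j => θ (zs j) + X j ω := by
      funext j
      simp only [hX]
      abel
    have hmain := loss_iterate_le (z := fun t => z t ω) hK hn₀ hsize hΔ0 hsep hs hr
      (fun t => hYX ▸ hz t ω) hω (not_lt.1 h2) hεL hLm hrad hcontr
    intro t
    exact ⟨(hmain t).2, misclust_iterate_le hp hΔ hsep hε0 hLp hmain t⟩
  have h1 : P.real {ω | loss θ (z 0 ω) zs ≤ L} ≤ P.real G + (P.real E₁ + P.real E₂) :=
    (measureReal_mono hsub).trans ((measureReal_union_le _ _).trans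
      (by gcongr; exact measureReal_union_le _ _))
  linarith

/-- The bounds of the theorem hold with the claimed probability in a single mixture model, when the
signal ratio `M` is large and the relative size `ρ` of the bound on the initial loss is small. -/
lemma measureReal_lloyd_bounds_ge {Ω : Type*} [MeasurableSpace Ω] {P : Measure Ω}
    [IsProbabilityMeasure P] {θ : Fin k → EuclideanSpace ℝ (Fin d)} {zs : Fin p → Fin k}
    {Y : Fin p → Ω → EuclideanSpace ℝ (Fin d)} (hY : IsGaussianMixture P θ zs Y)
    {z : ℕ → Ω → Fin p → Fin k}
    (hz : ∀ t ω, IsLloydStep (fun j => Y j ω) (z t ω) (z (t + 1) ω)) {α η L M ρ : ℝ} (hα : 0 < α)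
    (hsize : ∀ a, α * (p : ℝ) / (k : ℝ) ≤ clusterSize zs a) (hk : 1 ≤ k) (hp : 2 ≤ p)
    (hΔ : 80 ≤ sepMin θ) (hkΔ : (k : ℝ) ≤ sepMin θ) (hM : 0 < M) (hρ : 0 ≤ ρ)
    (hMeq : sepMin θ ^ 2 = M * ((k : ℝ) ^ 2 * ((k : ℝ) * (d : ℝ) / (p : ℝ) + 1)))
    (hL : L = ρ * (p * sepMin θ ^ 2 / k)) (hpL : p ≤ L) (hρ1 : ρ ≤ 1) (hρα : ρ ≤ α / 2)
    (hr1 : centerRadius α M ρ ≤ 1)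
    (hg : 3 * centerRadius α M ρ + displacementShare α M ρ ≤ 1)
    (hc : 1 / 2 ≤ exponentFactor α M ρ)
    (hinit : 1 - η ≤ P.real {ω | loss θ (z 0 ω) zs ≤ L}) {ε : ℝ}
    (hε : ε = Real.exp (4 * sepMin θ - exponentFactor α M ρ * sepMin θ ^ 2 / 8)) :
    1 - η - Real.exp (-sepMin θ) - (p : ℝ)⁻¹ ≤ P.real {ω | ∀ t,
      loss θ (z (t + 1) ω) zs ≤ p * ε + 1 / 2 * loss θ (z t ω) zs ∧
      misclust (z t ω) zs ≤ ε + (1 / 2) ^ t ∧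
      (3 * Real.log p ≤ t → misclust (z t ω) zs ≤ 2 * ε)} := by
  set Δ := sepMin θ with hΔdef
  set r := centerRadius α M ρ with hrdef
  set s := displacementShare α M ρ with hsdef
  set c := exponentFactor α M ρ with hcdef
  have hp0 : (0 : ℝ) < p := by positivity
  have hk0 : (0 : ℝ) < k := by exact_mod_cast hk
  have hk1 : (1 : ℝ) ≤ k := by exact_mod_cast hk
  have hΔ0 : 0 < Δ := by linarith
  have hsep : ∀ a b, a ≠ b → Δ ≤ ‖θ a - θ b‖ := fun a b hab => sepMin_le θ hab
  set n₀ : ℝ := α * p / k with hn₀def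
  have hn₀ : 0 < n₀ := by positivity
  set K : ℝ := 8 * ((k : ℝ) * d + p) with hKdef
  have hr0 : 0 ≤ r := by rw [hrdef, centerRadius]; positivity
  have h72 : 0 < ρ + 72 / M := by positivity
  have hs0 : 0 < s := by
    rw [hsdef, displacementShare]
    exact Real.sqrt_pos.2 (by positivity)
  have hL0 : 0 ≤ L := hp0.le.trans hpL
  -- in terms of `M` and `ρ`
  have hKeq : K = 8 * p * Δ ^ 2 / (k ^ 2 * M) := by
    rw [hMeq, hKdef]
    field_simp
  have hK0 : 0 ≤ K := by positivity
  have hKn₀ : K / n₀ ≤ 8 / (α * M) * Δ ^ 2 := by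
    have h1 : K / n₀ = 8 / (α * M) * Δ ^ 2 / k := by
      rw [hKeq, hn₀def]
      field_simp
    rw [h1]
    exact div_le_self (by positivity) hk1
  have hLK : L + 9 * K ≤ p * Δ ^ 2 / k * (ρ + 72 / M) := by
    have h1 : 9 * K = p * Δ ^ 2 / k * (72 / M) / k := by
      rw [hKeq]
      field_simp
      norm_num
    have h2 : p * Δ ^ 2 / k * (72 / M) / k ≤ p * Δ ^ 2 / k * (72 / M) :=
      div_le_self (by positivity) hk1
    rw [h1, hL, mul_add, mul_comm ρ]
    linarith
  have hLm : L ≤ n₀ / 2 * Δ ^ 2 := by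
    have : n₀ / 2 * Δ ^ 2 = α / 2 * (p * Δ ^ 2 / k) := by rw [hn₀def]; ring
    rw [this, hL]
    gcongr
  have hLp : L ≤ p * Δ ^ 2 := by
    rw [hL]
    calc ρ * (p * Δ ^ 2 / k) ≤ 1 * (p * Δ ^ 2) := by
          gcongr
          exact div_le_self (by positivity) hk1
      _ = _ := one_mul _
  have hrad : 2 * √(K / n₀) + √(8 * L * (L + 9 * K) / (n₀ ^ 2 * Δ ^ 2)) ≤ r * Δ := by
    have h1 : √(K / n₀) ≤ √(8 / (α * M)) * Δ := by
      refine (Real.sqrt_le_sqrt hKn₀).trans (le_of_eq ?_)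
      rw [Real.sqrt_mul (by positivity), Real.sqrt_sq hΔ0.le]
    have h2 : √(8 * L * (L + 9 * K) / (n₀ ^ 2 * Δ ^ 2)) ≤
        √(8 * ρ * (ρ + 72 / M) / α ^ 2) * Δ := by
      rw [← Real.sqrt_sq (by positivity : 0 ≤ √(8 * ρ * (ρ + 72 / M) / α ^ 2) * Δ), mul_pow,
        Real.sq_sqrt (by positivity)]
      apply Real.sqrt_le_sqrt
      rw [div_le_iff₀ (by positivity)]
      calc 8 * L * (L + 9 * K) ≤ 8 * L * (p * Δ ^ 2 / k * (ρ + 72 / M)) := by gcongr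
        _ = 8 * ρ * (ρ + 72 / M) / α ^ 2 * Δ ^ 2 * (n₀ ^ 2 * Δ ^ 2) := by
            rw [hL, hn₀def]
            field_simp
    rw [hrdef, centerRadius]
    linarith
  have hcontr : 256 * k * K * (L + 9 * K) ≤ n₀ ^ 2 * s ^ 2 * Δ ^ 4 := by
    rw [hsdef, displacementShare, Real.sq_sqrt (by positivity)]
    calc 256 * k * K * (L + 9 * K) ≤ 256 * k * K * (p * Δ ^ 2 / k * (ρ + 72 / M)) := by gcongr
      _ = n₀ ^ 2 * (2048 * (ρ + 72 / M) / (α ^ 2 * M)) * Δ ^ 4 := by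
          rw [hKeq, hn₀def]
          field_simp
          norm_num
  have hε0 : 0 ≤ ε := by rw [hε]; positivity
  have hΔ2 : 2 ≤ Δ := by linarith
  have hΔsq : 80 * Δ ≤ Δ ^ 2 := by rw [sq]; gcongr
  have hcsq : 1 / 2 * Δ ^ 2 ≤ c * Δ ^ 2 := by gcongr
  have hcΔ : 8 ≤ c * Δ ^ 2 := by linarith
  have hεhalf : ε ≤ 1 / 2 := by
    have h1 : 4 * Δ - c * Δ ^ 2 / 8 ≤ -1 := by linarith
    rw [hε]
    refine (Real.exp_le_exp.2 h1).trans ?_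
    rw [Real.exp_neg, one_div]
    gcongr
    linarith [Real.add_one_le_exp (1 : ℝ)]
  have hpε : 2 * (p * ε) ≤ L := by
    calc 2 * (p * ε) ≤ 2 * (p * (1 / 2)) := by gcongr
      _ = p := by ring
      _ ≤ L := hpL
  exact measureReal_lloyd_bounds_ge_of_parameters hY hz hΔ2 hsep hn₀ hsize hp hkΔ hs0 hr0 hr1 hg
    hcΔ hpε hLm hLp hrad hcontr hinit hε

end Parameters

end GMM

/-! ### Asymptotics of the parameters -/

theorem theorem2
    -- a sequence of Gaussian mixture models, indexed by `n`
    (p k d : ℕ → ℕ)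
    (θ : (n : ℕ) → Fin (k n) → EuclideanSpace ℝ (Fin (d n)))
    (zs : (n : ℕ) → Fin (p n) → Fin (k n))
    {Ω : ℕ → Type*} [∀ n, MeasurableSpace (Ω n)]
    (P : (n : ℕ) → Measure (Ω n)) [∀ n, IsProbabilityMeasure (P n)]
    (Y : (n : ℕ) → Fin (p n) → Ω n → EuclideanSpace ℝ (Fin (d n)))
    (hY : ∀ n, GMM.IsGaussianMixture (P n) (θ n) (zs n) (Y n))
    -- Lloyd's iterates `z n t`, started from a (data dependent, random) initializer `z n 0`
    (z : (n : ℕ) → ℕ → Ω n → Fin (p n) → Fin (k n))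
    (hzm : ∀ n t, Measurable (z n t))
    (hz : ∀ n t ω, GMM.IsLloydStep (fun j => Y n j ω) (z n t ω) (z n (t + 1) ω))
    -- signal condition and `p / k → ∞`
    (hsignal : Tendsto (fun n => GMM.sepMin (θ n) ^ 2 /
      ((k n : ℝ) ^ 2 * ((k n : ℝ) * (d n : ℝ) / (p n : ℝ) + 1))) atTop atTop)
    (hpk : Tendsto (fun n => (p n : ℝ) / (k n : ℝ)) atTop atTop)
    -- all the clusters have size at least `α p / k`
    (α : ℝ) (hα : 0 < α)
    (hsize : ∀ n a, α * (p n : ℝ) / (k n : ℝ) ≤ (GMM.clusterSize (zs n) a : ℝ))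
    -- initialization: the loss is `o(p Δ_min² / k)` with probability at least `1 - η`
    (η τ : ℕ → ℝ)
    (hτ : τ =o[atTop] fun n => (p n : ℝ) * GMM.sepMin (θ n) ^ 2 / (k n : ℝ))
    (hinit : ∀ n, 1 - η n ≤ (P n).real {ω | GMM.loss (θ n) (z n 0 ω) (zs n) ≤ τ n}) :
    -- `δ n` is the `o(1)` term
    ∃ δ : ℕ → ℝ, Tendsto δ atTop (𝓝 0) ∧
      ∀ᶠ n in atTop,
        1 - η n - Real.exp (-GMM.sepMin (θ n)) - (p n : ℝ)⁻¹ ≤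
          (P n).real {ω |
            (∀ t : ℕ, 1 ≤ t →
              GMM.loss (θ n) (z n t ω) (zs n) ≤
                (p n : ℝ) * Real.exp (-((1 + δ n) * GMM.sepMin (θ n) ^ 2 / 8)) +
                  (1 / 2) * GMM.loss (θ n) (z n (t - 1) ω) (zs n)) ∧
            (∀ t : ℕ, 1 ≤ t →
              GMM.misclust (z n t ω) (zs n) ≤
                Real.exp (-((1 + δ n) * GMM.sepMin (θ n) ^ 2 / 8)) + (1 / 2) ^ t) ∧
            (∀ t : ℕ, 3 * Real.log (p n : ℝ) ≤ (t : ℝ) →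
              GMM.misclust (z n t ω) (zs n) ≤
                Real.exp (-((1 + δ n) * GMM.sepMin (θ n) ^ 2 / 8)))} := by
  set Δ : ℕ → ℝ := fun n => GMM.sepMin (θ n) with hΔdef
  set D : ℕ → ℝ := fun n => (k n : ℝ) ^ 2 * ((k n : ℝ) * (d n : ℝ) / (p n : ℝ) + 1) with hD
  set M : ℕ → ℝ := fun n => Δ n ^ 2 / D n with hMdef
  set g : ℕ → ℝ := fun n => (p n : ℝ) * Δ n ^ 2 / (k n : ℝ) with hg
  -- adding `p` to `τ` leaves room for the ideal error while keeping the bound `o(p Δ² / k)`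
  set L : ℕ → ℝ := fun n => |τ n| + p n with hLdef
  set ρ : ℕ → ℝ := fun n => L n / g n with hρdef
  have hM : Tendsto M atTop atTop := hsignal
  have hk : ∀ᶠ n in atTop, 1 ≤ k n := by
    filter_upwards [hM.eventually_gt_atTop 0] with n hn
    by_contra hk0
    have hk0 : k n = 0 := by omega
    simp [hMdef, hD, hk0] at hn
  have hD1 : ∀ᶠ n in atTop, (k n : ℝ) ^ 2 ≤ D n ∧ 1 ≤ D n := by
    filter_upwards [hk] with n hn
    have hk1 : (1 : ℝ) ≤ k n := by exact_mod_cast hn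
    have h1 : (1 : ℝ) ≤ (k n : ℝ) * (d n : ℝ) / (p n : ℝ) + 1 := by
      have : (0 : ℝ) ≤ (k n : ℝ) * (d n : ℝ) / (p n : ℝ) := by positivity
      linarith
    have h2 : (k n : ℝ) ^ 2 ≤ D n := le_mul_of_one_le_right (by positivity) h1
    exact ⟨h2, (one_le_pow₀ hk1).trans h2⟩
  have hMeq : ∀ᶠ n in atTop, Δ n ^ 2 = M n * D n := by
    filter_upwards [hD1] with n hn
    have : D n ≠ 0 := by linarith [hn.2]
    simp only [hMdef]
    field_simp
  have hΔ0 : ∀ n, 0 ≤ Δ n := fun n => GMM.sepMin_nonneg (θ n)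
  have hΔ : Tendsto Δ atTop atTop := by
    refine tendsto_atTop_mono' _ ?_ (Real.tendsto_sqrt_atTop.comp hM)
    filter_upwards [hD1, hMeq, hM.eventually_ge_atTop 0] with n h1 h2 h3
    simp only [Function.comp]
    rw [Real.sqrt_le_left (hΔ0 n), h2]
    exact le_mul_of_one_le_right h3 h1.2
  have hkΔ : ∀ᶠ n in atTop, (k n : ℝ) ≤ Δ n := by
    filter_upwards [hD1, hMeq, hM.eventually_ge_atTop 1] with n h1 h2 h3
    refine le_of_sq_le_sq ?_ (hΔ0 n)
    rw [h2]
    exact h1.1.trans (le_mul_of_one_le_left (by linarith [h1.2]) h3)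
  have hp : ∀ᶠ n in atTop, 2 ≤ p n := by
    filter_upwards [hk, hpk.eventually_ge_atTop 2] with n h1 h2
    have hk1 : (1 : ℝ) ≤ k n := by exact_mod_cast h1
    rw [le_div_iff₀ (by linarith)] at h2
    have : (2 : ℝ) ≤ p n := by linarith
    exact_mod_cast this
  have hg0 : ∀ n, 0 ≤ g n := fun n => by positivity
  have hρ : Tendsto ρ atTop (𝓝 0) := by
    have h1 : Tendsto (fun n => |τ n / g n|) atTop (𝓝 0) := by
      simpa using hτ.tendsto_div_nhds_zero.abs
    have h2 : Tendsto (fun n => (p n : ℝ) / g n) atTop (𝓝 0) := by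
      refine squeeze_zero' (Eventually.of_forall fun n => by positivity) ?_ hΔ.inv_tendsto_atTop
      filter_upwards [hk, hp, hkΔ, hΔ.eventually_gt_atTop 0] with n h3 h4 h5 h6
      have hk1 : (0 : ℝ) < k n := by exact_mod_cast h3
      have hp1 : (0 : ℝ) < p n := by positivity
      have : (p n : ℝ) / g n = k n / Δ n ^ 2 := by
        simp only [hg]
        field_simp
      rw [this, div_le_iff₀ (by positivity), Pi.inv_apply]
      calc (k n : ℝ) ≤ Δ n := h5
        _ = (Δ n)⁻¹ * Δ n ^ 2 := by field_simp
    have h3 := h1.add h2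
    rw [add_zero] at h3
    refine h3.congr fun n => ?_
    simp only [hρdef, hLdef]
    rw [abs_div, abs_of_nonneg (hg0 n), add_div]
  obtain ⟨hr, hs, hc⟩ := GMM.tendsto_parameters (α := α) hM hρ
  set c : ℕ → ℝ := fun n => GMM.exponentFactor α (M n) (ρ n) with hcdef
  refine ⟨fun n => c n - 1 - 32 / Δ n - 8 * Real.log 2 / Δ n ^ 2, ?_, ?_⟩
  · have h1 : Tendsto (fun n => 32 / Δ n) atTop (𝓝 0) := hΔ.const_div_atTop 32
    have h2 : Tendsto (fun n => 8 * Real.log 2 / Δ n ^ 2) atTop (𝓝 0) :=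
      ((tendsto_pow_atTop two_ne_zero).comp hΔ).const_div_atTop _
    simpa using ((hc.sub_const 1).sub h1).sub h2
  have hg1 : Tendsto (fun n => 3 * GMM.centerRadius α (M n) (ρ n) +
      GMM.displacementShare α (M n) (ρ n)) atTop (𝓝 0) := by
    simpa using (hr.const_mul 3).add hs
  filter_upwards [hk, hp, hkΔ, hMeq, hΔ.eventually_ge_atTop 80, hM.eventually_gt_atTop 0,
    hρ.eventually_le_const one_pos, hρ.eventually_le_const (half_pos hα),
    hr.eventually_le_const one_pos, hg1.eventually_le_const one_pos,
    hc.eventually_const_le (by norm_num : (1 / 2 : ℝ) < 1)] with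
    n hkn hpn hkΔn hMn hΔn hMpos hρ1 hρα hr1 hg1n hcn
  have hkpos : (0 : ℝ) < k n := by exact_mod_cast hkn
  have hppos : (0 : ℝ) < p n := by positivity
  have hΔpos : 0 < Δ n := by linarith
  have hgpos : 0 < g n := by positivity
  have hρ0 : 0 ≤ ρ n := by positivity
  have hL : L n = ρ n * g n := by
    simp only [hρdef]
    field_simp
  have hinit' : 1 - η n ≤ (P n).real {ω | GMM.loss (θ n) (z n 0 ω) (zs n) ≤ L n} :=
    (hinit n).trans (measureReal_mono fun ω (hω : _ ≤ _) => hω.trans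
      ((le_abs_self _).trans (le_add_of_nonneg_right hppos.le)))
  have hmain := GMM.measureReal_lloyd_bounds_ge (hY n) (z := z n) (hz n) hα (hsize n) hkn hpn hΔn
    hkΔn hMpos hρ0 hMn hL (le_add_of_nonneg_left (abs_nonneg _)) hρ1 hρα hr1 hg1n hcn hinit' rfl
  refine hmain.trans (measureReal_mono ?_)
  set ε := Real.exp (4 * GMM.sepMin (θ n) -
    GMM.exponentFactor α (M n) (ρ n) * GMM.sepMin (θ n) ^ 2 / 8) with hε
  have hε0 : 0 < ε := Real.exp_pos _
  have hexp : Real.exp (-((1 + (c n - 1 - 32 / Δ n - 8 * Real.log 2 / Δ n ^ 2)) *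
      GMM.sepMin (θ n) ^ 2 / 8)) = 2 * ε := by
    have h1 : -((1 + (c n - 1 - 32 / Δ n - 8 * Real.log 2 / Δ n ^ 2)) *
        GMM.sepMin (θ n) ^ 2 / 8) = Real.log 2 + (4 * Δ n - c n * Δ n ^ 2 / 8) := by
      change -((1 + (c n - 1 - 32 / Δ n - 8 * Real.log 2 / Δ n ^ 2)) * Δ n ^ 2 / 8) = _
      field_simp
      ring
    rw [h1, Real.exp_add, Real.exp_log (by norm_num)]
  intro ω hω
  have hω : ∀ t, _ := hω
  simp only [hexp]
  refine ⟨fun t ht => ?_, fun t _ => ?_, fun t ht => (hω t).2.2 ht⟩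
  · have h1 := (hω (t - 1)).1
    rw [Nat.sub_add_cancel ht] at h1
    have : 0 ≤ p n * ε := by positivity
    linarith
  · linarith [(hω t).2.1]
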